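/- Let $\mathbb{B}^n$ be the set of binary strings of length $n$, and let $\log$ be the binary logarithm. Let $C(x)$ be the plain Kolmogorov complexity of a string $x$ with respect to a fixed optimal description mode. Let $\mathbf{m}(x)$ be the discrete a priori probability, i.e. the probability that a fixed universal probabilistic machine without input halts with output $x$, where universal means that its output distribution is maximal up to a constant factor among those of all probabilistic machines. Fix a computable encoding of finite sets of strings by strings, and let $C(A)$ and $\mathbf{m}(A)$ be the values of $C$ and $\mathbf{m}$ on the code of the finite set $A$. Let $x\in\mathbb{B}^n$ and $d\in\mathbb{R}$. The algorithmic prediction $d$-neighbourhood of $x$ is the union of all sets $A\subset\mathbb{B}^n$ such that $x\in A$ and $C(A)+\log|A|-C(x)\le d$. The probabilistic prediction $d$-neighbourhood of $x$ is the set of all strings $y$ such that $p(y\,|\,x)\ge 2^{-d}$, where $$p(y\,|\,x)=\frac{\sum_{A\ni x,y}\mathbf{m}(A)/|A|}{\sum_{A\ni x}\mathbf{m}(A)/|A|},$$ both sums being over the sets $A\subset\mathbb{B}^n$ with $C(A)\le 4n$ that contain the indicated strings. Theorem. There are constants $c$ and $N$, depending only on the choice of the description mode, the universal machine and the encoding,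 such that for all $n\ge N$, all $x\in\mathbb{B}^n$ and all $d\in\mathbb{R}$: (a) the algorithmic prediction $d$-neighbourhood of $x$ is contained in the probabilistic prediction $(d+c\log n)$-neighbourhood of $x$; (b) the probabilistic prediction $d$-neighbourhood of $x$ is contained in the algorithmic prediction $(d+c\log n)$-neighbourhood of $x$. -/

import Mathlib

namespace AlgStat

noncomputable section

/-- The plain Kolmogorov complexity `C(x)` of a binary string `x` with respect to the description
mode (decompressor) `D`: the least length of a string `p` with `D(p) = x`. -/
def complexity (D : List Bool →. List Bool) (x : List Bool) : ℕ :=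
  sInf {k : ℕ | ∃ p : List Bool, p.length = k ∧ x ∈ D p}

/-- `D` is an optimal description mode: it is partial computable and, up to an additive constant in
the length of descriptions, at least as good as any other partial computable description mode.
(In particular every string has a description, so the infimum in `complexity` is attained.) -/
def IsOptimal (D : List Bool →. List Bool) : Prop :=
  Partrec D ∧ ∀ D' : List Bool →. List Bool, Partrec D' →
    ∃ c : ℕ, ∀ p x : List Bool, x ∈ D' p → ∃ q : List Bool, x ∈ D q ∧ q.length ≤ p.length + c

/-- A probabilistic machine without input. It tosses one fair coin per step; `out w = some y` means
that, when the first `w.length` tosses gave the bits `w` (in this order), the machine has by then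
halted with output `y`, and `out w = none` means that it is still running. -/
structure ProbMachine where
  out : List Bool → Option (List Bool)
  computable_out : Computable out
  persist : ∀ (w : List Bool) (b : Bool) (y : List Bool), out w = some y → out (w ++ [b]) = some y

/-- The probability `m_M(x)` that the machine `M` halts with output `x`: the supremum (the limit)
over `k` of the probability that this has happened within `k` coin tosses. -/
def ProbMachine.prob (M : ProbMachine) (x : List Bool) : ℝ :=
  ⨆ k : ℕ, ((Finset.univ.filter
    fun w : Fin k → Bool => M.out (List.ofFn w) = some x).card : ℝ) / 2 ^ k

/-- `M` is universal: `m_M` is maximal, up to a constant factor, among all output distributions of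
probabilistic machines. Then `m_M` is the discrete a priori probability. -/
def ProbMachine.IsUniversal (M : ProbMachine) : Prop :=
  ∀ M' : ProbMachine, ∃ c : ℝ, ∀ x : List Bool, M'.prob x ≤ c * M.prob x

/-- `e` is a computable encoding of finite sets of strings by strings: the code of a set can be
computed from any list of its elements, and a list of the elements can be computed from the code. -/
def IsComputableEncoding (e : Finset (List Bool) → List Bool) : Prop :=
  (Computable fun l : List (List Bool) => e l.toFinset) ∧
  ∃ g : List Bool →. List (List Bool), Partrec g ∧
    ∀ A : Finset (List Bool), ∃ l ∈ g (e A), l.toFinset = A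

/-- The set `𝔹ⁿ` of all binary strings of length `n`. -/
def cube (n : ℕ) : Finset (List Bool) :=
  Finset.univ.image fun v : Fin n → Bool => List.ofFn v

/-- The optimality deficiency `δ(x, A) = C(A) + log₂ |A| - C(x)`. -/
def optDeficiency (D : List Bool →. List Bool) (e : Finset (List Bool) → List Bool)
    (x : List Bool) (A : Finset (List Bool)) : ℝ :=
  (complexity D (e A) : ℝ) + Real.logb 2 (A.card : ℝ) - (complexity D x : ℝ)

/-- The algorithmic prediction `d`-neighbourhood of a string `x` of length `n`: the union of all
sets `A ⊆ 𝔹ⁿ` with `x ∈ A` and `δ(x, A) ≤ d`. -/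
def algNbhd (D : List Bool →. List Bool) (e : Finset (List Bool) → List Bool)
    (x : List Bool) (d : ℝ) : Set (List Bool) :=
  {y | ∃ A : Finset (List Bool), A ⊆ cube x.length ∧ x ∈ A ∧ optDeficiency D e x A ≤ d ∧ y ∈ A}

/-- The sets `A ⊆ 𝔹ⁿ` of complexity at most `4n`, the models of the two-stage process. -/
def models (D : List Bool →. List Bool) (e : Finset (List Bool) → List Bool) (n : ℕ) :
    Finset (Finset (List Bool)) :=
  (cube n).powerset.filter fun A => complexity D (e A) ≤ 4 * n

/-- The conditional probability `p(y | x)` that `y ∈ A`, given that the two-stage process (choose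
a model `A` with probability `m(A)`, then a uniformly distributed element of `A`) outputs `x`. -/
def predProb (D : List Bool →. List Bool) (M : ProbMachine) (e : Finset (List Bool) → List Bool)
    (x y : List Bool) : ℝ :=
  (∑ A ∈ (models D e x.length).filter (fun A => x ∈ A ∧ y ∈ A), M.prob (e A) / (A.card : ℝ)) /
    (∑ A ∈ (models D e x.length).filter (fun A => x ∈ A), M.prob (e A) / (A.card : ℝ))

/-- The probabilistic prediction `d`-neighbourhood of `x`: all `y` with `p(y | x) ≥ 2^{-d}`. -/
def probNbhd (D : List Bool →. List Bool) (M : ProbMachine) (e : Finset (List Bool) → List Bool)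
    (x : List Bool) (d : ℝ) : Set (List Bool) :=
  {y | (2 : ℝ) ^ (-d) ≤ predProb D M e x y}

end

end AlgStat

open Nat.Partrec (Code)

namespace AlgStat

/-! ### Primitive recursive tools: staged computations, list operations, the cube as a list. -/

section Primitive

variable {α β : Type*} [Primcodable α] [Primcodable β]

/-! For strings `x`, `y` of length `n`, let κ(x, y) be the least value of C(A) + log |A| over the
sets A ⊆ 𝔹ⁿ containing both. Up to a factor polynomial in `n`, the sum of m(A)/|A| over the models
containing `x` and `y` is 2^(-κ(x, y)), with separate care for sets of complexity above 4n. For `y =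
x` this gives 2^(-C(x)): the singleton {x} shows κ(x, x) ≤ C(x) + O(1), and describing `x` by a set
and an index in it gives the converse up to O(log n). Hence p(y | x) is about 2^(-(κ(x, y) - C(x))),
and κ(x, y) - C(x) is the least deficiency of a set that puts `y` into the algorithmic
neighbourhood.

The lower bound on the sum (`exists_le_sum_models`) uses one term and m(A) ≥ 2^(-C(A) - O(log n)).
For the upper bound (`exists_sum_models_le`), group the sets by complexity `a` and integer log-size
`b`. There are polynomially many groups, and each term in a group is at most 2^(-a - b + O(log n)),
so it suffices that a group has at most 2^(a + b - κ + O(log n)) members (`exists_card_models_le`).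

The heart is `exists_simpler_model`: if about 2^j sets of type (a, b) contain both strings, then a
set of the same size bound and of complexity about a - j contains both, whence κ ≤ a - j + b + O(log
n). To find it, enumerate the at most 2^a sets of type (a, b) and select online about 2^(a - j) of
them, so that every pair lying in many enumerated sets lies in a selected one. A selected set is
described by its index in the selection. The selection is a deterministic multiplicative-weights
strategy, analysed by a potential (`coverStep_potential`). -/

theorem exists_primrec_stages {F : α →. β} (hF : Partrec F) :
    ∃ r : ℕ → α → Option β, Primrec₂ r ∧ (∀ s t a b, s ≤ t → r s a = some b → r t a = some b) ∧
      ∀ a b, b ∈ F a ↔ ∃ s, r s a = some b := by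
  obtain ⟨c, hc⟩ := Code.exists_code.1 hF
  have key : ∀ a m, m ∈ c.eval (Encodable.encode a) ↔ ∃ b ∈ F a, Encodable.encode b = m := by
    intro a m; rw [hc]; simp
  refine ⟨fun s a => (Code.evaln s c (Encodable.encode a)).bind Encodable.decode, ?_, ?_, ?_⟩
  · refine Primrec.option_bind (Code.primrec_evaln.comp
      ((Primrec.fst.pair (Primrec.const c)).pair (Primrec.encode.comp Primrec.snd))) ?_
    exact Primrec.decode.comp Primrec.snd
  · intro s t a b hst h
    obtain ⟨m, hm, hb⟩ := Option.bind_eq_some_iff.1 h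
    exact Option.bind_eq_some_iff.2 ⟨m, Code.evaln_mono hst hm, hb⟩
  · intro a b
    constructor
    · intro h
      obtain ⟨s, hs⟩ := Code.evaln_complete.1 ((key a _).2 ⟨b, h, rfl⟩)
      exact ⟨s, Option.bind_eq_some_iff.2 ⟨_, hs, Encodable.encodek b⟩⟩
    · rintro ⟨s, hs⟩
      obtain ⟨m, hm, hb⟩ := Option.bind_eq_some_iff.1 hs
      obtain ⟨b', hb', rfl⟩ := (key a m).1 (Code.evaln_sound hm)
      rw [Encodable.encodek] at hb
      cases hb; exact hb'

theorem primrec_nat_pow : Primrec₂ ((· ^ ·) : ℕ → ℕ → ℕ) :=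
  Primrec₂.unpaired'.1 Nat.Primrec.pow

theorem primrec_list_sum : Primrec (List.sum : List ℕ → ℕ) := by
  refine (Primrec.list_foldr Primrec.id (Primrec.const 0)
    (h := fun _ p => p.1 + p.2) ?_).of_eq fun l => ?_
  · exact Primrec.nat_add.comp (Primrec.fst.comp Primrec.snd) (Primrec.snd.comp Primrec.snd)
  · rfl

theorem primrec_list_filter {f : α → List β} {p : α → β → Bool} (hf : Primrec f)
    (hp : Primrec₂ p) : Primrec fun a => (f a).filter (p a) := by
  refine (Primrec.listFilterMap hf (g := fun a b => cond (p a b) (some b) none) ?_).of_eq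
    fun a => ?_
  · exact Primrec.cond hp (Primrec.option_some.comp Primrec.snd) (Primrec.const none)
  · rw [← List.filterMap_eq_filter]
    congr 1; funext b
    cases h : p a b <;> simp [Option.guard, h]

theorem primrec_list_mem [DecidableEq α] : PrimrecRel fun (a : α) (l : List α) => a ∈ l := by
  refine ((PrimrecRel.exists_mem_list (R := fun a b : α => a = b) Primrec.eq).comp
    Primrec.snd Primrec.fst).of_eq fun p => ?_
  simp

theorem primrec_list_any {f : α → List β} {p : α → β → Bool} (hf : Primrec f)
    (hp : Primrec₂ p) : Primrec fun a => (f a).any (p a) := by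
  refine (Primrec.list_foldr hf (Primrec.const false)
    (h := fun a q => p a q.1 || q.2) ?_).of_eq fun a => ?_
  · exact Primrec.or.comp (hp.comp Primrec.fst (Primrec.fst.comp Primrec.snd))
      (Primrec.snd.comp Primrec.snd)
  · induction f a with
    | nil => rfl
    | cons b l ih => simp [ih]

/-- All strings of length `n`, as a list. -/
def cubeList : ℕ → List (List Bool)
  | 0 => [[]]
  | n + 1 => (cubeList n).flatMap fun v => [false :: v, true :: v]

theorem mem_cubeList {n : ℕ} {x : List Bool} : x ∈ cubeList n ↔ x.length = n := by
  induction n generalizing x with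
  | zero => simp [cubeList]
  | succ n ih =>
    simp only [cubeList, List.mem_flatMap, ih, List.mem_cons, List.not_mem_nil, or_false]
    constructor
    · rintro ⟨v, rfl, rfl | rfl⟩ <;> simp
    · intro h
      match x, h with
      | b :: v, h => exact ⟨v, by simpa using h, by cases b <;> simp⟩

theorem nodup_cubeList (n : ℕ) : (cubeList n).Nodup := by
  induction n with
  | zero => simp [cubeList]
  | succ n ih =>
    rw [cubeList, List.nodup_flatMap]
    refine ⟨fun v _ => by simp, ih.imp fun {u v} huv => ?_⟩
    simp [Function.onFun, huv, List.disjoint_left]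

theorem primrec_cubeList : Primrec cubeList := by
  refine (Primrec.nat_rec₁ [[]]
    (f := fun _ l => l.flatMap fun v => [false :: v, true :: v]) ?_).of_eq fun n => ?_
  · refine Primrec.list_flatMap Primrec.snd ?_
    exact Primrec.list_cons.comp (Primrec.list_cons.comp (Primrec.const false) Primrec.snd)
      (Primrec.list_cons.comp (Primrec.list_cons.comp (Primrec.const true) Primrec.snd)
        (Primrec.const []))
  · induction n with
    | zero => rfl
    | succ n ih => simp only [cubeList, ← ih]

theorem mem_cube {n : ℕ} {x : List Bool} : x ∈ cube n ↔ x.length = n := by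
  simp only [cube, Finset.mem_image, Finset.mem_univ, true_and]
  constructor
  · rintro ⟨v, rfl⟩; simp
  · rintro rfl; exact ⟨x.get, by simp⟩

theorem card_cube (n : ℕ) : (cube n).card = 2 ^ n := by
  rw [cube, Finset.card_image_of_injective _ List.ofFn_injective]; simp

theorem cubeList_toFinset (n : ℕ) : (cubeList n).toFinset = cube n := by
  ext x; simp [mem_cube, mem_cubeList]

end Primitive

/-! ### Enumeration without repetition. -/

section Enumeration

variable {α β : Type*}

/-- Adjoin `z` at the end of `l` unless it is there already. -/
def insertNew [DecidableEq β] (l : List β) (z : β) : List β := if z ∈ l then l else l ++ [z]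

/-- The distinct elements of `f 0, …, f (t - 1)`, in the order of their first appearance. -/
def enumUpTo [DecidableEq β] (f : ℕ → List β) (t : ℕ) : List β :=
  ((List.range t).flatMap f).foldl insertNew []

theorem mem_foldl_insertNew [DecidableEq β] (l acc : List β) (z : β) :
    z ∈ l.foldl insertNew acc ↔ z ∈ acc ∨ z ∈ l := by
  induction l generalizing acc with
  | nil => simp
  | cons a l ih =>
    rw [List.foldl_cons, ih, insertNew]
    split_ifs with h
    · simp only [List.mem_cons]
      constructor
      · tauto
      · rintro (h' | rfl | h') <;> tauto
    · simp only [List.mem_append, List.mem_cons, List.not_mem_nil, or_false]; tauto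

theorem nodup_foldl_insertNew [DecidableEq β] (l acc : List β) (h : acc.Nodup) :
    (l.foldl insertNew acc).Nodup := by
  induction l generalizing acc with
  | nil => exact h
  | cons a l ih =>
    refine ih _ ?_
    rw [insertNew]
    split_ifs with ha
    · exact h
    · exact List.nodup_append.2 ⟨h, by simp, by
        intro x hx y hy; simp at hy; subst hy; rintro rfl; exact ha hx⟩

theorem prefix_foldl_insertNew [DecidableEq β] (l acc : List β) :
    acc <+: l.foldl insertNew acc := by
  induction l generalizing acc with
  | nil => exact List.prefix_rfl
  | cons a l ih =>
    refine List.IsPrefix.trans ?_ (ih _)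
    rw [insertNew]
    split_ifs
    · exact List.prefix_rfl
    · exact List.prefix_append _ _

theorem mem_enumUpTo [DecidableEq β] {f : ℕ → List β} {t : ℕ} {z : β} :
    z ∈ enumUpTo f t ↔ ∃ s < t, z ∈ f s := by
  simp [enumUpTo, mem_foldl_insertNew]

theorem nodup_enumUpTo [DecidableEq β] (f : ℕ → List β) (t : ℕ) : (enumUpTo f t).Nodup :=
  nodup_foldl_insertNew _ _ List.nodup_nil

/-- New elements are only appended, so the index of an element never changes and can serve as its
description. -/
theorem prefix_enumUpTo [DecidableEq β] (f : ℕ → List β) {s t : ℕ} (h : s ≤ t) :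
    enumUpTo f s <+: enumUpTo f t := by
  obtain ⟨d, rfl⟩ := Nat.exists_eq_add_of_le h
  rw [enumUpTo, enumUpTo, List.range_add, List.flatMap_append, List.foldl_append]
  exact prefix_foldl_insertNew _ _

theorem primrec_enumUpTo [Primcodable α] [Primcodable β] [DecidableEq β] {f : α → ℕ → List β}
    (hf : Primrec₂ f) : Primrec₂ fun a t => enumUpTo (f a) t := by
  refine Primrec.list_foldl (Primrec.list_flatMap (Primrec.list_range.comp Primrec.snd)
    (g := fun p s => f p.1 s) ?_) (Primrec.const []) (h := fun _ q => insertNew q.1 q.2) ?_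
  · exact hf.comp (Primrec.fst.comp Primrec.fst) Primrec.snd
  · have h1 : Primrec fun p : (α × ℕ) × (List β × β) => p.2.1 := Primrec.fst.comp Primrec.snd
    have h2 : Primrec fun p : (α × ℕ) × (List β × β) => p.2.2 := Primrec.snd.comp Primrec.snd
    exact Primrec.ite (primrec_list_mem.comp h2 h1) h1 (Primrec.list_concat.comp h1 h2)

end Enumeration

/-! ### Self-delimiting codes for numbers. -/

section Coding

/-- The number whose binary digits, least significant first, are the given bits. -/
def bitsVal (l : List Bool) : ℕ := l.foldr (fun b m => b.toNat + 2 * m) 0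

theorem exists_bitsVal (k : ℕ) {i : ℕ} (hi : i < 2 ^ k) :
    ∃ u : List Bool, u.length = k ∧ bitsVal u = i := by
  induction k generalizing i with
  | zero => exact ⟨[], rfl, by simp at hi; simp [bitsVal, hi]⟩
  | succ k ih =>
    obtain ⟨u, hu, hv⟩ := ih (i := i / 2) (by rw [pow_succ] at hi; omega)
    refine ⟨decide (i % 2 = 1) :: u, by simp [hu], ?_⟩
    simp only [bitsVal, List.foldr_cons] at hv ⊢
    rw [hv]
    rcases Nat.mod_two_eq_zero_or_one i with h | h <;> simp [h] <;> omega

theorem primrec_bitsVal : Primrec bitsVal := by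
  refine Primrec.list_foldr Primrec.id (Primrec.const 0) (h := fun _ p => Bool.toNat p.1 + 2 * p.2) ?_
  exact Primrec.nat_add.comp ((Primrec.dom_bool Bool.toNat).comp (Primrec.fst.comp Primrec.snd))
    (Primrec.nat_mul.comp (Primrec.const 2) (Primrec.snd.comp Primrec.snd))

/-- Split `w = 1ᴸ 0 u r` with `|u| = L` into the number with binary digits `u` and the rest `r`. -/
def parse (w : List Bool) : Option (ℕ × List Bool) :=
  let L := (w.takeWhile id).length
  if 2 * L + 1 ≤ w.length then
    some (bitsVal ((w.drop (L + 1)).take L), (w.drop (L + 1)).drop L)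
  else none

/-- The unary prefix fixes how many bits are read, so later bits cannot alter the number that was
parsed. -/
theorem parse_append {w : List Bool} {q : ℕ} {r : List Bool} (h : parse w = some (q, r))
    (v : List Bool) : parse (w ++ v) = some (q, r ++ v) := by
  simp only [parse] at h ⊢
  split_ifs at h with hL
  have hne : (w.takeWhile id).length ≠ w.length := by omega
  have ht : (w ++ v).takeWhile id = w.takeWhile id := by
    rw [List.takeWhile_append, if_neg hne]
  rw [ht, if_pos (by rw [List.length_append]; omega)]
  simp only [Option.some.injEq, Prod.mk.injEq] at h ⊢
  obtain ⟨rfl, rfl⟩ := h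
  rw [List.drop_append_of_le_length (by omega),
    List.take_append_of_le_length (by rw [List.length_drop]; omega),
    List.drop_append_of_le_length (by rw [List.length_drop]; omega)]
  exact ⟨rfl, rfl⟩

theorem exists_parse (q : ℕ) : ∃ u : List Bool, u.length = 2 * q.size + 1 ∧
    ∀ r, parse (u ++ r) = some (q, r) := by
  obtain ⟨v, hv, hq⟩ := exists_bitsVal q.size (Nat.lt_size_self q)
  refine ⟨List.replicate q.size true ++ false :: v, by simp [hv]; omega, fun r => ?_⟩
  suffices h : parse (List.replicate q.size true ++ false :: v) = some (q, []) by
    simpa using parse_append h r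
  have ht : (List.replicate q.size true ++ false :: v).takeWhile id
      = List.replicate q.size true := by
    rw [List.takeWhile_append]; simp
  have hd : (List.replicate q.size true ++ false :: v).drop (q.size + 1) = v := by
    rw [List.drop_append]; simp
  simp only [parse, ht, List.length_replicate, hd]
  rw [if_pos (by simp [hv]; omega), ← hv]
  simp [hq]

theorem primrec_parse : Primrec parse := by
  have hL : Primrec fun w : List Bool => (w.takeWhile id).length :=
    Primrec.list_length.comp (Primrec.list_takeWhile Primrec.id)
  have hd : Primrec fun w : List Bool => w.drop ((w.takeWhile id).length + 1) :=
    Primrec.list_drop.comp (Primrec.succ.comp hL) Primrec.id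
  refine Primrec.ite (Primrec.nat_le.comp (Primrec.succ.comp
    (Primrec.nat_mul.comp (Primrec.const 2) hL)) Primrec.list_length) ?_ (Primrec.const none)
  exact Primrec.option_some.comp ((primrec_bitsVal.comp (Primrec.list_take.comp hL hd)).pair
    (Primrec.list_drop.comp hL hd))

end Coding

/-! ### Upper bounds on plain complexity. -/

section Complexity

variable {D : List Bool →. List Bool}

theorem complexity_le {p x : List Bool} (h : x ∈ D p) : complexity D x ≤ p.length :=
  Nat.sInf_le ⟨p, rfl, h⟩

theorem IsOptimal.exists_complexity_le (hD : IsOptimal D) :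
    ∃ c, ∀ x, complexity D x ≤ x.length + c := by
  obtain ⟨c, hc⟩ := hD.2 (fun p => Part.some p) Partrec.some
  refine ⟨c, fun x => ?_⟩
  obtain ⟨q, hq, hl⟩ := hc x x (Part.mem_some _)
  exact (complexity_le hq).trans hl

theorem IsOptimal.exists_program (hD : IsOptimal D) (x : List Bool) :
    ∃ p, p.length = complexity D x ∧ x ∈ D p := by
  obtain ⟨c, hc⟩ := hD.2 (fun p => Part.some p) Partrec.some
  obtain ⟨q, hq, -⟩ := hc x x (Part.mem_some _)
  exact Nat.sInf_mem (s := {k | ∃ p : List Bool, p.length = k ∧ x ∈ D p}) ⟨_, q, rfl, hq⟩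

/-- An element of an enumerable set with at most `2 ^ k` elements can be described by its index. -/
theorem IsOptimal.exists_complexity_enum_le (hD : IsOptimal D) {β : Type*} [Primcodable β]
    [DecidableEq β] {f : ℕ → ℕ → List β} (hf : Primrec₂ f) {h : β → List Bool}
    (hh : Computable h) :
    ∃ c : ℕ, ∀ q k s b, b ∈ f q s →
      (∀ S : Finset β, (∀ b ∈ S, ∃ s, b ∈ f q s) → S.card ≤ 2 ^ k) →
      complexity D (h b) ≤ k + 2 * q.size + c := by
  -- A description is a self-delimiting code of the parameter followed by exactly `k` bits for the
  -- index. The value of `k` need not be coded, because the index is all that remains.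
  let g : ℕ × List Bool → ℕ → Option β := fun qr t => (enumUpTo (f qr.1) t)[bitsVal qr.2]?
  have hg : Primrec₂ g := by
    refine Primrec.list_getElem?.comp ((primrec_enumUpTo hf).comp
      (Primrec.fst.comp Primrec.fst) Primrec.snd) ?_
    exact primrec_bitsVal.comp (Primrec.snd.comp Primrec.fst)
  have hmono : ∀ qr, ∀ {a m n}, m ≤ n → a ∈ g qr m → a ∈ g qr n := by
    intro qr a m n hmn ha
    obtain ⟨l, hl⟩ := prefix_enumUpTo (f qr.1) hmn
    simp only [g, Option.mem_def] at ha ⊢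
    rw [← hl, List.getElem?_append_left (List.getElem?_eq_some_iff.1 ha).1, ha]
  have hD' : Partrec fun w => (parse w : Part (ℕ × List Bool)).bind fun qr =>
      (Nat.rfindOpt (g qr)).map h := by
    refine Partrec.bind (Computable.ofOption primrec_parse.to_comp) ?_
    refine Partrec.map ((Partrec.rfindOpt hg.to_comp).comp Computable.snd) ?_
    exact hh.comp Computable.snd
  obtain ⟨c, hc⟩ := hD.2 _ hD'
  refine ⟨c + 1, fun q k s b hb hS => ?_⟩
  have hmem : b ∈ enumUpTo (f q) (s + 1) := mem_enumUpTo.2 ⟨s, Nat.lt_succ_self s, hb⟩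
  obtain ⟨i, hi, hib⟩ := List.getElem_of_mem hmem
  have hik : i < 2 ^ k := by
    refine hi.trans_le ?_
    rw [← List.toFinset_card_of_nodup (nodup_enumUpTo (f q) (s + 1))]
    refine hS _ fun b hb => ?_
    obtain ⟨s, -, h⟩ := mem_enumUpTo.1 (List.mem_toFinset.1 hb)
    exact ⟨s, h⟩
  obtain ⟨r, hr, hri⟩ := exists_bitsVal k hik
  obtain ⟨u, hu, hup⟩ := exists_parse q
  obtain ⟨p, hp, hpl⟩ := hc (u ++ r) (h b) (by
    rw [hup r]
    simp only [Part.coe_some, Part.bind_some]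
    refine Part.mem_map _ ((Nat.rfindOpt_mono (hmono _)).2 ⟨s + 1, ?_⟩)
    simp only [g, hri, Option.mem_def]
    rw [List.getElem?_eq_getElem hi, hib])
  have := complexity_le hp
  rw [List.length_append] at hpl
  omega

end Complexity

/-! ### A priori probability versus complexity. -/

section Probability

variable (M : ProbMachine)

/-- The probability that `M` halts with output `x` within `k` steps. -/
noncomputable def ProbMachine.probAt (k : ℕ) (x : List Bool) : ℝ :=
  (((cube k).filter fun w => M.out w = some x).card : ℝ) / 2 ^ k

theorem ProbMachine.prob_eq (x : List Bool) : M.prob x = ⨆ k, M.probAt k x := by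
  unfold ProbMachine.prob ProbMachine.probAt
  congr 1; funext k
  rw [cube, Finset.filter_image, Finset.card_image_of_injective _ List.ofFn_injective]

theorem ProbMachine.probAt_nonneg (k : ℕ) (x : List Bool) : 0 ≤ M.probAt k x := by
  unfold ProbMachine.probAt; positivity

theorem ProbMachine.sum_probAt_le_one (k : ℕ) (S : Finset (List Bool)) :
    ∑ x ∈ S, M.probAt k x ≤ 1 := by
  unfold ProbMachine.probAt
  rw [← Finset.sum_div, div_le_one (by positivity), ← Nat.cast_sum, ← Finset.card_biUnion]
  · have : ((2 : ℝ) ^ k) = ((cube k).card : ℝ) := by rw [card_cube]; simp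
    rw [this, Nat.cast_le]
    exact Finset.card_le_card (Finset.biUnion_subset.2 fun x _ => Finset.filter_subset _ _)
  · intro x _ y _ hxy
    rw [Function.onFun, Finset.disjoint_left]
    intro w hw hw'
    rw [Finset.mem_filter] at hw hw'
    exact hxy (Option.some.inj (hw.2.symm.trans hw'.2))

theorem ProbMachine.probAt_le_one (k : ℕ) (x : List Bool) : M.probAt k x ≤ 1 := by
  simpa using M.sum_probAt_le_one k {x}

/-- By `persist`, both one-bit extensions of a halting toss sequence halt with the same output, so
the count at least doubles with each toss. -/
theorem ProbMachine.monotone_probAt (x : List Bool) : Monotone fun k => M.probAt k x := by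
  refine monotone_nat_of_le_succ fun k => ?_
  unfold ProbMachine.probAt
  rw [div_le_div_iff₀ (by positivity) (by positivity), pow_succ, ← mul_assoc, mul_right_comm]
  refine mul_le_mul_of_nonneg_right ?_ (by positivity)
  have h : (((cube k).filter fun w => M.out w = some x) ×ˢ (Finset.univ : Finset Bool)).card ≤
      ((cube (k + 1)).filter fun w => M.out w = some x).card := by
    refine Finset.card_le_card_of_injOn (fun p => p.1 ++ [p.2]) ?_ ?_
    · rintro ⟨w, b⟩ hw
      simp only [Finset.coe_product, Set.mem_prod, Finset.mem_coe, Finset.mem_filter,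
        mem_cube] at hw ⊢
      exact ⟨by simp [hw.1.1], M.persist w b x hw.1.2⟩
    · rintro ⟨w, b⟩ _ ⟨w', b'⟩ _ h
      have := List.append_inj' h rfl
      simp_all
  rw [Finset.card_product, Finset.card_univ, Fintype.card_bool] at h
  exact_mod_cast h

theorem ProbMachine.bddAbove_probAt (x : List Bool) :
    BddAbove (Set.range fun k => M.probAt k x) :=
  ⟨1, by rintro _ ⟨k, rfl⟩; exact M.probAt_le_one k x⟩

theorem ProbMachine.probAt_le_prob (k : ℕ) (x : List Bool) : M.probAt k x ≤ M.prob x := by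
  rw [M.prob_eq]
  exact le_ciSup (M.bddAbove_probAt x) k

theorem ProbMachine.prob_nonneg (x : List Bool) : 0 ≤ M.prob x :=
  (M.probAt_nonneg 0 x).trans (M.probAt_le_prob 0 x)

theorem ProbMachine.sum_prob_le_one (S : Finset (List Bool)) : ∑ x ∈ S, M.prob x ≤ 1 := by
  have h : Filter.Tendsto (fun k => ∑ x ∈ S, M.probAt k x) Filter.atTop
      (nhds (∑ x ∈ S, M.prob x)) := tendsto_finsetSum S fun x _ => by
    rw [M.prob_eq]
    exact tendsto_atTop_ciSup (M.monotone_probAt x) (M.bddAbove_probAt x)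
  exact le_of_tendsto' h fun k => M.sum_probAt_le_one k S

theorem ProbMachine.prob_le_one (x : List Bool) : M.prob x ≤ 1 := by
  simpa using M.sum_prob_le_one {x}

/-- The event that the tosses begin with `u` has probability 2^(-|u|) and forces the output `x`,
after `r` further tosses that only provide running time. -/
theorem ProbMachine.le_prob_of_out_append {u x : List Bool} {r : ℕ}
    (h : ∀ v : List Bool, v.length = r → M.out (u ++ v) = some x) :
    (2 : ℝ)⁻¹ ^ u.length ≤ M.prob x := by
  refine le_trans ?_ (M.probAt_le_prob (u.length + r) x)
  unfold ProbMachine.probAt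
  rw [le_div_iff₀ (by positivity), pow_add, inv_pow, inv_mul_cancel_left₀ (by positivity)]
  have : (cube r).card ≤ ((cube (u.length + r)).filter fun w => M.out w = some x).card := by
    refine Finset.card_le_card_of_injOn (fun v => u ++ v) ?_ ?_
    · intro v hv
      simp only [Finset.mem_coe, Finset.mem_filter, mem_cube] at hv ⊢
      exact ⟨by simp [hv], h v hv⟩
    · intro v _ v' _ h
      exact List.append_cancel_left h
  rw [card_cube] at this
  exact_mod_cast this

theorem length_filter_cubeList (k : ℕ) (P : List Bool → Bool) :
    ((cubeList k).filter P).length = ((cube k).filter fun w => P w = true).card := by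
  rw [← cubeList_toFinset, ← List.toFinset_filter,
    List.toFinset_card_of_nodup ((nodup_cubeList k).filter _)]

/-- Probabilities are approximable from below, so the strings of probability above 2^(-k) can be
enumerated within those of probability at least 2^(-k). There are at most 2^k of the latter, so an
index of `k` bits suffices. -/
theorem ProbMachine.exists_complexity_le {D : List Bool →. List Bool} (hD : IsOptimal D) :
    ∃ c : ℕ, ∀ k x, (2 : ℝ)⁻¹ ^ k < M.prob x → complexity D x ≤ k + 2 * k.size + c := by
  obtain ⟨r, hr, hmono, hmem⟩ := exists_primrec_stages (Computable.ofOption M.computable_out)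
  simp only [Part.mem_ofOption, Option.mem_def] at hmem
  -- A stage codes a number T of tosses and a time bound t. It lists the strings whose probability
  -- after T tosses, as far as t steps of simulation reveal it, is at least 2^(-k).
  let F : ℕ → ℕ → List (List Bool) := fun k s =>
    ((cubeList s.unpair.1).filterMap (r s.unpair.2)).filter fun z =>
      decide (2 ^ s.unpair.1 ≤ 2 ^ k *
        ((cubeList s.unpair.1).filter fun w => decide (r s.unpair.2 w = some z)).length)
  have hF : Primrec₂ F := by
    have h1 : Primrec fun p : ℕ × ℕ => p.2.unpair.1 :=
      Primrec.fst.comp (Primrec.unpair.comp Primrec.snd)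
    have h2 : Primrec fun p : ℕ × ℕ => p.2.unpair.2 :=
      Primrec.snd.comp (Primrec.unpair.comp Primrec.snd)
    refine primrec_list_filter (Primrec.listFilterMap (primrec_cubeList.comp h1) ?_) ?_
    · exact hr.comp (h2.comp Primrec.fst) Primrec.snd
    · refine PrimrecPred.decide (Primrec.nat_le.comp
        (primrec_nat_pow.comp (Primrec.const 2) (h1.comp Primrec.fst))
        (Primrec.nat_mul.comp
          (primrec_nat_pow.comp (Primrec.const 2) (Primrec.fst.comp Primrec.fst))
          (Primrec.list_length.comp (primrec_list_filter
            (primrec_cubeList.comp (h1.comp Primrec.fst)) ?_))))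
      refine PrimrecPred.decide (Primrec.eq.comp (hr.comp (h2.comp (Primrec.fst.comp Primrec.fst))
        Primrec.snd) (Primrec.option_some.comp (Primrec.snd.comp Primrec.fst)))
  obtain ⟨c, hc⟩ := hD.exists_complexity_enum_le hF (h := id) Computable.id
  refine ⟨c, fun k x hx => ?_⟩
  have hsound : ∀ z s, z ∈ F k s → (2 : ℝ)⁻¹ ^ k ≤ M.prob z := by
    intro z s hz
    simp only [F, List.mem_filter, decide_eq_true_eq] at hz
    refine le_trans ?_ (M.probAt_le_prob s.unpair.1 z)
    unfold ProbMachine.probAt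
    rw [le_div_iff₀ (by positivity), inv_pow, inv_mul_le_iff₀ (by positivity)]
    have h := hz.2
    rw [length_filter_cubeList] at h
    have h' : ((cube s.unpair.1).filter fun w => decide (r s.unpair.2 w = some z) = true).card
        ≤ ((cube s.unpair.1).filter fun w => M.out w = some z).card := by
      refine Finset.card_le_card fun w hw => ?_
      simp only [Finset.mem_filter, decide_eq_true_eq] at hw ⊢
      exact ⟨hw.1, (hmem w z).2 ⟨_, hw.2⟩⟩
    exact_mod_cast h.trans (Nat.mul_le_mul_left _ h')
  rw [M.prob_eq] at hx
  -- The strict inequality in the hypothesis makes a finite number of tosses exceed the threshold.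
  obtain ⟨T, hT⟩ := exists_lt_of_lt_ciSup hx
  have hstage : ∃ t, ∀ w ∈ (cube T).filter (fun w => M.out w = some x), r t w = some x := by
    choose! t ht using fun w (hw : w ∈ (cube T).filter (fun w => M.out w = some x)) =>
      (hmem w x).1 (Finset.mem_filter.1 hw).2
    exact ⟨((cube T).filter (fun w => M.out w = some x)).sup t,
      fun w hw => hmono _ _ _ _ (Finset.le_sup hw) (ht w hw)⟩
  obtain ⟨t, ht⟩ := hstage
  unfold ProbMachine.probAt at hT
  rw [lt_div_iff₀ (by positivity), inv_pow, inv_mul_lt_iff₀ (by positivity)] at hT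
  have hT' : 2 ^ T < 2 ^ k * ((cube T).filter fun w => M.out w = some x).card := by
    exact_mod_cast hT
  have hcard : ((cube T).filter fun w => M.out w = some x).card ≤
      ((cube T).filter fun w => decide (r t w = some x) = true).card := by
    refine Finset.card_le_card fun w hw => ?_
    simp only [Finset.mem_filter, decide_eq_true_eq]
    exact ⟨(Finset.mem_filter.1 hw).1, ht w hw⟩
  refine hc k k (Nat.pair T t) x ?_ fun S hS => ?_
  · simp only [F, List.mem_filter, decide_eq_true_eq, Nat.unpair_pair, List.mem_filterMap]
    constructor
    · have : ((cube T).filter fun w => M.out w = some x).Nonempty := by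
        rw [← Finset.card_pos]; by_contra h0
        simp only [not_lt, nonpos_iff_eq_zero] at h0; rw [h0] at hT'; simp at hT'
      obtain ⟨w, hw⟩ := this
      exact ⟨w, mem_cubeList.2 (mem_cube.1 (Finset.mem_filter.1 hw).1), ht w hw⟩
    · rw [length_filter_cubeList]
      exact hT'.le.trans (Nat.mul_le_mul_left _ hcard)
  · have h1 : ∑ z ∈ S, (2 : ℝ)⁻¹ ^ k ≤ 1 := by
      refine le_trans (Finset.sum_le_sum fun z hz => ?_) (M.sum_prob_le_one S)
      obtain ⟨s, hs⟩ := hS z hz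
      exact hsound z s hs
    rw [Finset.sum_const, nsmul_eq_mul, inv_pow, mul_inv_le_iff₀ (by positivity), one_mul] at h1
    exact_mod_cast h1

/-- A universal machine outputs `x` at least as often as the machine that guesses a program. -/
theorem ProbMachine.IsUniversal.exists_le_prob {M : ProbMachine} (hM : M.IsUniversal)
    {D : List Bool →. List Bool} (hD : IsOptimal D) :
    ∃ c : ℕ, ∀ x, (2 : ℝ)⁻¹ ^ (complexity D x + 2 * (complexity D x).size + c) ≤ M.prob x := by
  obtain ⟨r, hr, hmono, hmem⟩ := exists_primrec_stages hD.1
  -- The tosses give a self-delimiting code of a length, then a program of this length. All further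
  -- tosses only extend the running time, which is `w.length`.
  let out : List Bool → Option (List Bool) := fun w => (parse w).bind fun ar =>
    if ar.1 ≤ ar.2.length then r w.length (ar.2.take ar.1) else none
  have hout : Primrec out := by
    have h1 : Primrec fun p : List Bool × (ℕ × List Bool) => p.2.1 :=
      Primrec.fst.comp Primrec.snd
    have h2 : Primrec fun p : List Bool × (ℕ × List Bool) => p.2.2 :=
      Primrec.snd.comp Primrec.snd
    refine Primrec.option_bind primrec_parse (Primrec.ite
      (Primrec.nat_le.comp h1 (Primrec.list_length.comp h2)) ?_ (Primrec.const none))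
    exact hr.comp (Primrec.list_length.comp Primrec.fst) (Primrec.list_take.comp h1 h2)
  let M' : ProbMachine :=
    { out := out
      computable_out := hout.to_comp
      persist := by
        intro w b y h
        obtain ⟨⟨a, u⟩, hp, hu⟩ := Option.bind_eq_some_iff.1 h
        simp only at hu
        split_ifs at hu with hau
        refine Option.bind_eq_some_iff.2 ⟨(a, u ++ [b]), parse_append hp [b], ?_⟩
        simp only
        rw [if_pos (by rw [List.length_append]; omega), List.take_append_of_le_length hau]
        exact hmono _ _ _ _ (by simp) hu }
  obtain ⟨c, hc⟩ := hM M'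
  obtain ⟨m, hm⟩ := pow_unbounded_of_one_lt (max c 1) (one_lt_two : (1 : ℝ) < 2)
  refine ⟨m + 1, fun x => ?_⟩
  obtain ⟨p, hp, hpx⟩ := hD.exists_program x
  obtain ⟨u, hu, hup⟩ := exists_parse (complexity D x)
  obtain ⟨s, hs⟩ := (hmem p x).1 hpx
  have h1 : (2 : ℝ)⁻¹ ^ (u ++ p).length ≤ M'.prob x := by
    refine M'.le_prob_of_out_append (r := s) fun v hv => ?_
    refine Option.bind_eq_some_iff.2 ⟨(complexity D x, p ++ v), ?_, ?_⟩
    · rw [List.append_assoc]; exact hup _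
    · simp only
      rw [if_pos (by rw [List.length_append]; omega), ← hp, List.take_left']
      · exact hmono _ _ _ _ (by simp only [List.length_append]; omega) hs
      · rfl
  have h2 : M'.prob x ≤ 2 ^ m * M.prob x :=
    (hc x).trans (mul_le_mul_of_nonneg_right ((le_max_left _ _).trans hm.le) (M.prob_nonneg x))
  have h3 : complexity D x + 2 * (complexity D x).size + (m + 1) = (u ++ p).length + m := by
    rw [List.length_append]; omega
  rw [h3, pow_add, inv_pow _ m, mul_inv_le_iff₀ (by positivity), mul_comm]
  exact h1.trans h2

end Probability

/-! ### Online selection of a small covering subfamily. -/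

section OnlineCover

variable {α υ : Type*} (inc : υ → α → Bool) (pts : α → List υ) (q Λ : ℕ)

/-- The weight of the point `u` when the sets `st.1` have arrived and the sets `st.2` among them
have been picked: zero if `u` is covered by a picked set, and otherwise `(1 + 1 / q) ^ m`, scaled
by a power of `q`, if `m` sets containing `u` have arrived. -/
def coverWeight (st : List α × List α) (u : υ) : ℕ :=
  if st.2.any (inc u) then 0
  else (q + 1) ^ (st.1.filter (inc u)).length *
    q ^ (st.1.length - (st.1.filter (inc u)).length)

/-- Pick the arriving set `A` if the points in it have total weight at least `Λ`. -/
def coverStep (st : List α × List α) (A : α) : List α × List α :=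
  (A :: st.1, if Λ * q ^ st.1.length ≤ ((pts A).map (coverWeight inc q st)).sum
    then A :: st.2 else st.2)

/-- The sets picked from the list `l` of sets that arrive one by one. -/
def coverPicks (l : List α) : List α := (l.foldl (coverStep inc pts q Λ) ([], [])).2

variable {inc pts q Λ}

theorem coverWeight_cons_left (st : List α × List α) (A : α) (u : υ) :
    coverWeight inc q (A :: st.1, st.2) u =
      q * coverWeight inc q st u + if inc u A then coverWeight inc q st u else 0 := by
  have hle : (st.1.filter (inc u)).length ≤ st.1.length := List.length_filter_le _ _
  simp only [coverWeight]
  by_cases hc : st.2.any (inc u)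
  · simp [hc]
  · simp only [hc, if_false, Bool.false_eq_true]
    by_cases hA : inc u A
    · rw [List.filter_cons_of_pos hA, if_pos hA, List.length_cons, List.length_cons,
        Nat.add_sub_add_right, pow_succ]
      ring
    · rw [List.filter_cons_of_neg hA, if_neg hA, List.length_cons, Nat.sub_add_comm hle, pow_succ]
      ring

theorem coverWeight_cons_right (st : List α × List α) (l : List α) (A : α) (u : υ) :
    coverWeight inc q (l, A :: st.2) u =
      if inc u A then 0 else coverWeight inc q (l, st.2) u := by
  simp only [coverWeight, List.any_cons]
  by_cases hA : inc u A <;> simp [hA]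

theorem foldl_coverStep_fst (l : List α) (st : List α × List α) :
    (l.foldl (coverStep inc pts q Λ) st).1 = l.reverse ++ st.1 := by
  induction l generalizing st with
  | nil => rfl
  | cons A l ih => rw [List.foldl_cons, ih]; simp [coverStep]

theorem subset_foldl_coverStep_snd (l : List α) (st : List α × List α) :
    st.2 ⊆ (l.foldl (coverStep inc pts q Λ) st).2 := by
  induction l generalizing st with
  | nil => exact fun _ h => h
  | cons A l ih =>
    refine List.Subset.trans ?_ (ih _)
    simp only [coverStep]
    split_ifs
    · exact List.subset_cons_self _ _
    · exact fun _ h => h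

/-- Decisions are never revoked, so the picked sets can be enumerated along with the arriving ones.
-/
theorem coverPicks_subset_of_prefix {l l' : List α} (h : l <+: l') :
    coverPicks inc pts q Λ l ⊆ coverPicks inc pts q Λ l' := by
  obtain ⟨m, rfl⟩ := h
  rw [coverPicks, coverPicks, List.foldl_append]
  exact subset_foldl_coverStep_snd _ _

theorem coverPicks_subset (l : List α) : coverPicks inc pts q Λ l ⊆ l := by
  suffices h : ∀ (l : List α) (st : List α × List α),
      (l.foldl (coverStep inc pts q Λ) st).2 ⊆ st.2 ++ l by
    simpa [coverPicks] using h l ([], [])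
  intro l
  induction l with
  | nil => intro st; simp
  | cons A l ih =>
    intro st B hB
    have := ih _ hB
    simp only [coverStep, List.mem_append, List.mem_cons] at this ⊢
    split_ifs at this
    · simp only [List.mem_cons] at this; tauto
    · tauto

/-- Divided by Λ q^(L + 1), where L is the number of arrivals, the inequality reads Φ/Λ + picks ≤ 1
+ L/q, with Φ the unscaled total weight. A set of weight W that is not picked raises Φ by W/q < Λ/q,
while a picked one lowers Φ by at least W ≥ Λ. The scaling by powers of `q` keeps everything in ℕ.
-/
theorem coverStep_potential {U : Finset υ} (hΛ : U.card = Λ) (l : List α)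
    (hnd : ∀ A ∈ l, (pts A).Nodup) (hpts : ∀ A ∈ l, ∀ u, u ∈ pts A ↔ u ∈ U ∧ inc u A = true)
    {st : List α × List α} (hst : st = l.foldl (coverStep inc pts q Λ) ([], [])) :
    q * ∑ u ∈ U, coverWeight inc q st u + Λ * q ^ (l.length + 1) * st.2.length ≤
      Λ * q ^ l.length * (q + l.length) := by
  subst hst
  induction l using List.reverseRecOn with
  | nil => simp [coverWeight, hΛ, mul_comm]
  | append_singleton l A ih =>
    specialize ih (fun B hB => hnd B (by simp [hB])) (fun B hB => hpts B (by simp [hB]))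
    rw [List.foldl_append, List.foldl_cons, List.foldl_nil]
    have hlen := congrArg List.length (foldl_coverStep_fst (inc := inc) (pts := pts) (q := q)
      (Λ := Λ) l ([], []))
    set st := l.foldl (coverStep inc pts q Λ) ([], []) with hst
    simp only [List.append_nil, List.length_reverse] at hlen
    have hW : ((pts A).map (coverWeight inc q st)).sum =
        ∑ u ∈ U, if inc u A then coverWeight inc q st u else 0 := by
      classical
      rw [← List.sum_toFinset _ (hnd A (by simp)), ← Finset.sum_filter]
      congr 1
      ext u
      rw [List.mem_toFinset, hpts A (by simp), Finset.mem_filter]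
    simp only [coverStep, hlen, List.length_append, List.length_singleton]
    rw [hW]
    set W := ∑ u ∈ U, if inc u A then coverWeight inc q st u else 0 with hWdef
    set Φ := ∑ u ∈ U, coverWeight inc q st u with hΦ
    have hcons : ∑ u ∈ U, coverWeight inc q (A :: st.1, st.2) u = q * Φ + W := by
      rw [hΦ, hWdef, Finset.mul_sum, ← Finset.sum_add_distrib]
      exact Finset.sum_congr rfl fun u _ => coverWeight_cons_left st A u
    split_ifs with hpick
    · have hpicked : ∑ u ∈ U, coverWeight inc q (A :: st.1, A :: st.2) u + q * W = q * Φ := by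
        rw [hΦ, hWdef, Finset.mul_sum, Finset.mul_sum, ← Finset.sum_add_distrib]
        refine Finset.sum_congr rfl fun u _ => ?_
        rw [coverWeight_cons_right, coverWeight_cons_left]
        by_cases hu : inc u A <;> simp [hu]
      rw [List.length_cons]
      have e1 : q * (q * W) ≥ q * (q * (Λ * q ^ l.length)) := by gcongr
      have e2 := Nat.mul_le_mul_left q ih
      have e3 : q * ∑ u ∈ U, coverWeight inc q (A :: st.1, A :: st.2) u + q * (q * W) =
          q * (q * Φ) := by rw [← Nat.mul_add, hpicked]
      have e4 : Λ * q ^ (l.length + 1) * (q + (l.length + 1)) =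
        q * (Λ * q ^ l.length * (q + l.length)) + Λ * q ^ (l.length + 1) := by ring
      have e5 : Λ * q ^ (l.length + 1 + 1) * (st.2.length + 1) =
        q * (Λ * q ^ (l.length + 1) * st.2.length) + q * (q * (Λ * q ^ l.length)) := by ring
      rw [Nat.mul_add] at e2
      omega
    · rw [hcons]
      have e1 : q * W ≤ q * (Λ * q ^ l.length) := by gcongr; omega
      have e2 := Nat.mul_le_mul_left q ih
      have e4 : Λ * q ^ (l.length + 1) * (q + (l.length + 1)) =
        q * (Λ * q ^ l.length * (q + l.length)) + q * (Λ * q ^ l.length) := by ring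
      have e5 : Λ * q ^ (l.length + 1 + 1) * st.2.length =
        q * (Λ * q ^ (l.length + 1) * st.2.length) := by ring
      rw [Nat.mul_add] at e2 ⊢
      omega

theorem coverPicks_length_le {U : Finset υ} (hΛ : U.card = Λ) (hΛ0 : 0 < Λ) (hq : 0 < q)
    (l : List α) (hnd : ∀ A ∈ l, (pts A).Nodup)
    (hpts : ∀ A ∈ l, ∀ u, u ∈ pts A ↔ u ∈ U ∧ inc u A = true) :
    q * (coverPicks inc pts q Λ l).length ≤ q + l.length := by
  have h := coverStep_potential (q := q) hΛ l hnd hpts rfl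
  have h' : Λ * q ^ l.length * (q * (coverPicks inc pts q Λ l).length) ≤
      Λ * q ^ l.length * (q + l.length) := by
    refine le_trans (le_of_eq ?_) ((Nat.le_add_left _ _).trans h)
    rw [coverPicks, pow_succ]; ring
  exact Nat.le_of_mul_le_mul_left h' (by positivity)

theorem two_mul_pow_self_le {q : ℕ} (hq : 0 < q) : 2 * q ^ q ≤ (q + 1) ^ q := by
  have hq' : (0 : ℝ) < q := by exact_mod_cast hq
  have h := one_add_mul_le_pow (a := (1 : ℝ) / q) (by have : (0:ℝ) ≤ 1 / q := by positivity
                                                      linarith) q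
  rw [mul_one_div_cancel hq'.ne', one_add_div hq'.ne', div_pow, le_div_iff₀ (by positivity)] at h
  have : (2 : ℝ) * q ^ q ≤ (q + 1) ^ q := by linarith
  exact_mod_cast this

/-- A point that lies in many of the arriving sets is covered by a picked one. -/
theorem exists_mem_coverPicks {U : Finset υ} (hΛ : U.card = Λ) (hq : 0 < q)
    (l : List α) (hnd : ∀ A ∈ l, (pts A).Nodup)
    (hpts : ∀ A ∈ l, ∀ u, u ∈ pts A ↔ u ∈ U ∧ inc u A = true) {m : ℕ}
    (hm : Λ * (q + l.length) < q * 2 ^ m) {u : υ} (hu : u ∈ U)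
    (hcount : q * m ≤ (l.filter (inc u)).length) :
    ∃ A ∈ coverPicks inc pts q Λ l, inc u A = true := by
  by_contra hno
  have h := coverStep_potential (q := q) hΛ l hnd hpts rfl
  have hfst := foldl_coverStep_fst (inc := inc) (pts := pts) (q := q) (Λ := Λ) l ([], [])
  rw [coverPicks] at hno
  set st := l.foldl (coverStep inc pts q Λ) ([], []) with hst
  have hw : coverWeight inc q st u = (q + 1) ^ (l.filter (inc u)).length *
      q ^ (l.length - (l.filter (inc u)).length) := by
    have : ¬ st.2.any (inc u) = true := by simpa using hno
    rw [coverWeight, if_neg this, hfst]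
    simp [List.filter_reverse]
  set k := (l.filter (inc u)).length with hk
  have hkl : k ≤ l.length := List.length_filter_le _ _
  -- An uncovered point in at least q m arrived sets has unscaled weight at least (1 + 1/q)^(q m) ≥
  -- 2^m, which would exceed the total weight allowed by the potential.
  have h1 : 2 ^ m * q ^ k ≤ (q + 1) ^ k := by
    obtain ⟨d, hd⟩ := Nat.exists_eq_add_of_le hcount
    rw [hd, pow_add, pow_add, pow_mul, pow_mul, ← mul_assoc, ← mul_pow]
    exact Nat.mul_le_mul (Nat.pow_le_pow_left (two_mul_pow_self_le hq) m)
      (Nat.pow_le_pow_left (Nat.le_succ q) d)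
  have h2 : q * (2 ^ m * q ^ l.length) ≤ Λ * q ^ l.length * (q + l.length) := by
    refine le_trans ?_ ((Nat.le_add_right _ _).trans h)
    refine Nat.mul_le_mul_left q (le_trans ?_
      (Finset.single_le_sum (f := coverWeight inc q st) (fun _ _ => Nat.zero_le _) hu))
    rw [hw, ← Nat.add_sub_cancel' hkl, pow_add, ← mul_assoc, Nat.add_sub_cancel' hkl]
    exact Nat.mul_le_mul_right _ h1
  have h3 : q ^ l.length * (q * 2 ^ m) ≤ q ^ l.length * (Λ * (q + l.length)) := by
    convert h2 using 1 <;> ring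
  exact absurd (Nat.le_of_mul_le_mul_left h3 (by positivity)) (not_le.2 hm)

theorem primrec_coverPicks {γ : Type*} [Primcodable α] [Primcodable υ] [Primcodable γ]
    (hinc : Primrec₂ inc) (hp : Primrec pts) {q Λ : γ → ℕ} {l : γ → List α}
    (hq : Primrec q) (hΛ : Primrec Λ) (hl : Primrec l) :
    Primrec fun x => coverPicks inc pts (q x) (Λ x) (l x) := by
  refine Primrec.snd.comp (Primrec.list_foldl hl (Primrec.const ([], []))
    (h := fun x p => coverStep inc pts (q x) (Λ x) p.1 p.2) ?_)
  have hst : Primrec fun p : γ × ((List α × List α) × α) => p.2.1 :=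
    Primrec.fst.comp Primrec.snd
  have hA : Primrec fun p : γ × ((List α × List α) × α) => p.2.2 :=
    Primrec.snd.comp Primrec.snd
  have hq' : Primrec fun p : γ × ((List α × List α) × α) => q p.1 := hq.comp Primrec.fst
  have hweight : Primrec₂ fun (p : γ × ((List α × List α) × α)) (u : υ) =>
      coverWeight inc (q p.1) p.2.1 u := by
    have h1 : Primrec fun x : (γ × ((List α × List α) × α)) × υ => x.1.2.1.1 :=
      Primrec.fst.comp (hst.comp Primrec.fst)
    have h2 : Primrec fun x : (γ × ((List α × List α) × α)) × υ => x.1.2.1.2 :=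
      Primrec.snd.comp (hst.comp Primrec.fst)
    have hinc' : Primrec₂ fun (x : (γ × ((List α × List α) × α)) × υ) (A : α) => inc x.2 A :=
      hinc.comp (Primrec.snd.comp Primrec.fst) Primrec.snd
    have hf : Primrec fun x : (γ × ((List α × List α) × α)) × υ =>
        (x.1.2.1.1.filter (inc x.2)).length :=
      Primrec.list_length.comp (primrec_list_filter h1 hinc')
    refine Primrec.ite (Primrec.eq.comp (primrec_list_any h2 hinc') (Primrec.const true))
      (Primrec.const 0) ?_
    exact Primrec.nat_mul.comp
      (primrec_nat_pow.comp (Primrec.succ.comp (hq'.comp Primrec.fst)) hf)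
      (primrec_nat_pow.comp (hq'.comp Primrec.fst)
        (Primrec.nat_sub.comp (Primrec.list_length.comp h1) hf))
  refine Primrec.pair (Primrec.list_cons.comp hA (Primrec.fst.comp hst)) (Primrec.ite
    (Primrec.nat_le.comp (Primrec.nat_mul.comp (hΛ.comp Primrec.fst) (primrec_nat_pow.comp hq'
      (Primrec.list_length.comp (Primrec.fst.comp hst))))
      (primrec_list_sum.comp (Primrec.list_map (hp.comp hA) hweight)))
    (Primrec.list_cons.comp hA (Primrec.snd.comp hst)) (Primrec.snd.comp hst))

end OnlineCover

/-- The list of all elements of `𝔹ⁿ` that occur in `l`, in the order of `cubeList n`. -/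
def restrictCube (n : ℕ) (l : List (List Bool)) : List (List Bool) :=
  (cubeList n).filter fun x => decide (x ∈ l)

theorem mem_restrictCube {n : ℕ} {l : List (List Bool)} {x : List Bool} :
    x ∈ restrictCube n l ↔ x ∈ cube n ∧ x ∈ l := by
  simp [restrictCube, mem_cubeList, mem_cube]

theorem nodup_restrictCube (n : ℕ) (l : List (List Bool)) : (restrictCube n l).Nodup :=
  (nodup_cubeList n).filter _

theorem restrictCube_toFinset {n : ℕ} {l : List (List Bool)} (h : l.toFinset ⊆ cube n) :
    (restrictCube n l).toFinset = l.toFinset := by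
  ext x
  rw [List.mem_toFinset, mem_restrictCube, List.mem_toFinset]
  exact ⟨fun hx => hx.2, fun hx => ⟨h (List.mem_toFinset.2 hx), hx⟩⟩

theorem primrec_restrictCube : Primrec₂ restrictCube :=
  primrec_list_filter (primrec_cubeList.comp Primrec.fst)
    (PrimrecPred.decide (primrec_list_mem.comp Primrec.snd (Primrec.snd.comp Primrec.fst)))

/-- A finite set of eventually listed elements is listed in full at one common stage. -/
theorem card_le_of_monotone_lists {β : Type*} {K : ℕ} {f : ℕ → List β}
    (hmono : ∀ s t, s ≤ t → f s ⊆ f t) (hlen : ∀ t, (f t).length ≤ K) (S : Finset β)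
    (hS : ∀ b ∈ S, ∃ s, b ∈ f s) : S.card ≤ K := by
  classical
  choose! s hs using hS
  refine le_trans ?_ ((List.toFinset_card_le (f (S.sup s))).trans (hlen _))
  exact Finset.card_le_card fun b hb =>
    List.mem_toFinset.2 (hmono _ _ (Finset.le_sup hb) (hs b hb))

/-! ### Enumeration of the models of given complexity and size bound. -/

section Models

variable (r : ℕ → List Bool → Option (List (List Bool)))

/-- The sets of at most `2 ^ (b + 1) - 1` strings of length `n` that are found in fewer than `t`
steps among the outputs of programs of length `a`. -/
def smallModels (n a b t : ℕ) : List (List (List Bool)) :=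
  (enumUpTo (fun s => ((cubeList a).filterMap (r s)).map (restrictCube n)) t).filter
    fun A => decide (A.length < 2 ^ (b + 1))

variable {r}

theorem mem_smallModels {n a b t : ℕ} {A : List (List Bool)} :
    A ∈ smallModels r n a b t ↔ (∃ s < t, ∃ p ∈ cube a, ∃ l, r s p = some l ∧
      restrictCube n l = A) ∧ A.length < 2 ^ (b + 1) := by
  simp only [smallModels, List.mem_filter, mem_enumUpTo, List.mem_map, List.mem_filterMap,
    mem_cubeList, mem_cube, decide_eq_true_eq]
  constructor
  · rintro ⟨⟨s, hs, l, ⟨p, hp, hl⟩, h⟩, hA⟩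
    exact ⟨⟨s, hs, p, hp, l, hl, h⟩, hA⟩
  · rintro ⟨⟨s, hs, p, hp, l, hl, h⟩, hA⟩
    exact ⟨⟨s, hs, l, ⟨p, hp, hl⟩, h⟩, hA⟩

theorem nodup_smallModels (n a b t : ℕ) : (smallModels r n a b t).Nodup :=
  (nodup_enumUpTo _ _).filter _

theorem prefix_smallModels (n a b : ℕ) {s t : ℕ} (h : s ≤ t) :
    smallModels r n a b s <+: smallModels r n a b t :=
  (prefix_enumUpTo _ h).filter _

/-- By stage `t` each program of length `a` has produced at most one list, so distinct models have
distinct programs. -/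
theorem length_smallModels_le (hr : ∀ s t p l, s ≤ t → r s p = some l → r t p = some l)
    (n a b t : ℕ) : (smallModels r n a b t).length ≤ 2 ^ a := by
  rw [← List.toFinset_card_of_nodup (nodup_smallModels n a b t), ← card_cube a]
  have h : ∀ A ∈ (smallModels r n a b t).toFinset, ∃ p, p ∈ cube a ∧ ∃ l, r t p = some l ∧
      restrictCube n l = A := by
    intro A hA
    obtain ⟨⟨s, hs, p, hp, l, hl, h⟩, -⟩ := mem_smallModels.1 (List.mem_toFinset.1 hA)
    exact ⟨p, hp, l, hr _ _ _ _ hs.le hl, h⟩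
  choose! p hp l hl hA using h
  refine Finset.card_le_card_of_injOn p hp fun A hA₁ B hB₁ hAB => ?_
  rw [← hA A hA₁, ← hA B hB₁]
  have h1 := hl A hA₁
  rw [hAB, hl B hB₁] at h1
  rw [Option.some.inj h1]

theorem primrec_smallModels (hr : Primrec₂ r) {γ : Type*} [Primcodable γ] {n a b t : γ → ℕ}
    (hn : Primrec n) (ha : Primrec a) (hb : Primrec b) (ht : Primrec t) :
    Primrec fun x => smallModels r (n x) (a x) (b x) (t x) := by
  refine primrec_list_filter ((primrec_enumUpTo (f := fun x s =>
    ((cubeList (a x)).filterMap (r s)).map (restrictCube (n x))) ?_).comp Primrec.id ht) ?_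
  · refine Primrec.list_map (Primrec.listFilterMap (primrec_cubeList.comp (ha.comp Primrec.fst))
      (hr.comp (Primrec.snd.comp Primrec.fst) Primrec.snd)) ?_
    exact primrec_restrictCube.comp (hn.comp (Primrec.fst.comp Primrec.fst)) Primrec.snd
  · exact PrimrecPred.decide (Primrec.nat_lt.comp (Primrec.list_length.comp Primrec.snd)
      (primrec_nat_pow.comp (Primrec.const 2) (Primrec.succ.comp (hb.comp Primrec.fst))))

end Models

/-! ### Complexity of strings and of models. -/

section Descriptions

variable {D : List Bool →. List Bool} {e : Finset (List Bool) → List Bool}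

/-- The stages approximate the composition of `D` with the decoding of sets, so a shortest program
for the code of a set yields a list of its elements. Normalising by `restrictCube` removes
repetitions, which turns the length test into a test of cardinality. -/
theorem exists_model_stages (hD : IsOptimal D) (he : IsComputableEncoding e) :
    ∃ r : ℕ → List Bool → Option (List (List Bool)), Primrec₂ r ∧
      (∀ s t p l, s ≤ t → r s p = some l → r t p = some l) ∧
      ∀ n b (A : Finset (List Bool)), A ⊆ cube n → A.card < 2 ^ (b + 1) →
        ∃ l t, l ∈ smallModels r n (complexity D (e A)) b t ∧ l.toFinset = A := by
  obtain ⟨-, g, hg, hgA⟩ := he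
  obtain ⟨r, hr, hmono, hmem⟩ := exists_primrec_stages (hD.1.bind (hg.comp Computable.snd).to₂)
  refine ⟨r, hr, hmono, fun n b A hA hb => ?_⟩
  obtain ⟨p, hp, hpA⟩ := hD.exists_program (e A)
  obtain ⟨l, hl, rfl⟩ := hgA A
  obtain ⟨s, hs⟩ := (hmem p l).1 (Part.mem_bind hpA hl)
  refine ⟨restrictCube n l, s + 1, mem_smallModels.2
    ⟨⟨s, Nat.lt_succ_self s, p, mem_cube.2 hp, l, hs, rfl⟩, ?_⟩, restrictCube_toFinset hA⟩
  rwa [← List.toFinset_card_of_nodup (nodup_restrictCube n l), restrictCube_toFinset hA]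

/-- A string is described by a set containing it and its index in this set. -/
theorem exists_complexity_le_of_mem (hD : IsOptimal D) (he : IsComputableEncoding e) :
    ∃ c : ℕ, ∀ n b (A : Finset (List Bool)) x, A ⊆ cube n → x ∈ A → A.card < 2 ^ (b + 1) →
      complexity D x ≤ complexity D (e A) + b + 1 +
        2 * (Nat.pair n (Nat.pair (complexity D (e A)) b)).size + c := by
  obtain ⟨r, hr, hmono, hA⟩ := exists_model_stages hD he
  -- At most 2^a models with fewer than 2^(b + 1) elements each contribute at most 2^(a + b + 1)
  -- strings, so the index needs a + b + 1 bits.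
  let f : ℕ → ℕ → List (List Bool) := fun q t =>
    (smallModels r q.unpair.1 q.unpair.2.unpair.1 q.unpair.2.unpair.2 t).flatten
  have hf : Primrec₂ f := by
    have h1 : Primrec fun p : ℕ × ℕ => p.1.unpair := Primrec.unpair.comp Primrec.fst
    have h2 : Primrec fun p : ℕ × ℕ => p.1.unpair.2.unpair :=
      Primrec.unpair.comp (Primrec.snd.comp h1)
    exact Primrec.list_flatten.comp (primrec_smallModels hr (Primrec.fst.comp h1)
      (Primrec.fst.comp h2) (Primrec.snd.comp h2) Primrec.snd)
  obtain ⟨c, hc⟩ := hD.exists_complexity_enum_le hf (h := id) Computable.id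
  refine ⟨c, fun n b A x hAn hx hb => ?_⟩
  obtain ⟨l, t, hl, rfl⟩ := hA n b A hAn hb
  refine hc _ (complexity D (e l.toFinset) + b + 1) t x ?_ fun S hS => ?_
  · simp only [f, Nat.unpair_pair]
    exact List.mem_flatten.2 ⟨l, hl, List.mem_toFinset.1 hx⟩
  · refine card_le_of_monotone_lists (fun s t hst => ?_) (fun t => ?_) S hS
    · intro z hz
      simp only [f, List.mem_flatten] at hz ⊢
      obtain ⟨m, hm, hz⟩ := hz
      exact ⟨m, (prefix_smallModels _ _ _ hst).subset hm, hz⟩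
    · simp only [f, Nat.unpair_pair, List.length_flatten]
      refine (List.sum_le_card_nsmul _ (2 ^ (b + 1)) fun k hk => ?_).trans ?_
      · obtain ⟨m, hm, rfl⟩ := List.mem_map.1 hk
        exact (mem_smallModels.1 hm).2.le
      · rw [List.length_map, smul_eq_mul, add_assoc, pow_add _ _ (b + 1)]
        exact Nat.mul_le_mul_right _ (length_smallModels_le hmono _ _ _ _)

theorem exists_complexity_singleton_le (hD : IsOptimal D) (he : IsComputableEncoding e) :
    ∃ c : ℕ, ∀ x, complexity D (e {x}) ≤ complexity D x + c := by
  have h : Partrec fun p => (D p).map fun x => e [x].toFinset := by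
    refine hD.1.map (he.1.comp (Primrec.to_comp ?_))
    exact Primrec.list_cons.comp Primrec.snd (Primrec.const [])
  obtain ⟨c, hc⟩ := hD.2 _ h
  refine ⟨c, fun x => ?_⟩
  obtain ⟨p, hp, hx⟩ := hD.exists_program x
  obtain ⟨q, hq, hl⟩ := hc p (e {x}) (by simpa using Part.mem_map (fun x => e [x].toFinset) hx)
  exact (complexity_le hq).trans (hp ▸ hl)

/-- The cube replaces sets of complexity above 4n, which are not models. -/
theorem exists_complexity_cube_le (hD : IsOptimal D) (he : IsComputableEncoding e) :
    ∃ c : ℕ, ∀ n, complexity D (e (cube n)) ≤ 2 * n.size + c := by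
  obtain ⟨c, hc⟩ := hD.exists_complexity_enum_le (f := fun q _ => [q])
    (Primrec.list_cons.comp Primrec.fst (Primrec.const []))
    (h := fun n => e (cubeList n).toFinset) (he.1.comp primrec_cubeList.to_comp)
  refine ⟨c, fun n => ?_⟩
  have := hc n 0 0 n (by simp) fun S hS => ?_
  · rwa [cubeList_toFinset, Nat.zero_add] at this
  · have : S ⊆ {n} := fun b hb => by
      obtain ⟨s, hs⟩ := hS b hb
      simpa using hs
    simpa using Finset.card_le_card this

/-- If two strings belong to many sets of the same complexity, then they belong to a simpler set
of about the same size. -/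
theorem exists_simpler_model (hD : IsOptimal D) (he : IsComputableEncoding e) :
    ∃ c : ℕ, ∀ n a b j x y (F : Finset (Finset (List Bool))), a ≤ 4 * n →
      (∀ A ∈ F, A ⊆ cube n ∧ x ∈ A ∧ y ∈ A ∧ complexity D (e A) = a ∧ A.card < 2 ^ (b + 1)) →
      2 ^ j * (6 * n + 2) ≤ F.card →
      j ≤ a ∧ ∃ A : Finset (List Bool), A ⊆ cube n ∧ x ∈ A ∧ y ∈ A ∧ A.card < 2 ^ (b + 1) ∧
        complexity D (e A) ≤
          a - j + 1 + 2 * (Nat.pair n (Nat.pair a (Nat.pair b j))).size + c := by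
  obtain ⟨r, hr, hmono, hA⟩ := exists_model_stages hD he
  -- The points to be covered are pairs of strings, so one selection serves all `x` and `y` and need
  -- not know them.
  let inc : List Bool × List Bool → List (List Bool) → Bool := fun u A =>
    decide (u.1 ∈ A) && decide (u.2 ∈ A)
  let pts : List (List Bool) → List (List Bool × List Bool) := fun A =>
    A.flatMap fun x => A.map fun y => (x, y)
  have hinc : Primrec₂ inc := Primrec.and.comp
    (PrimrecPred.decide (primrec_list_mem.comp (Primrec.fst.comp Primrec.fst) Primrec.snd))
    (PrimrecPred.decide (primrec_list_mem.comp (Primrec.snd.comp Primrec.fst) Primrec.snd))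
  have hpts : Primrec pts := Primrec.list_flatMap Primrec.id
    (Primrec.list_map Primrec.fst ((Primrec.snd.comp Primrec.fst).pair Primrec.snd).to₂)
  let f' : ℕ → ℕ → ℕ → ℕ → ℕ → List (List (List Bool)) := fun n a b j t =>
    coverPicks inc pts (2 ^ j) (2 ^ n * 2 ^ n) (smallModels r n a b t)
  let f : ℕ → ℕ → List (List (List Bool)) := fun q t => f' q.unpair.1 q.unpair.2.unpair.1
    q.unpair.2.unpair.2.unpair.1 q.unpair.2.unpair.2.unpair.2 t
  have hf : Primrec₂ f := by
    have h1 : Primrec fun p : ℕ × ℕ => p.1.unpair := Primrec.unpair.comp Primrec.fst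
    have h2 : Primrec fun p : ℕ × ℕ => p.1.unpair.2.unpair :=
      Primrec.unpair.comp (Primrec.snd.comp h1)
    have h3 : Primrec fun p : ℕ × ℕ => p.1.unpair.2.unpair.2.unpair :=
      Primrec.unpair.comp (Primrec.snd.comp h2)
    have hpow := primrec_nat_pow.comp (Primrec.const 2) (Primrec.fst.comp h1)
    exact primrec_coverPicks hinc hpts
      (primrec_nat_pow.comp (Primrec.const 2) (Primrec.snd.comp h3))
      (Primrec.nat_mul.comp hpow hpow)
      (primrec_smallModels hr (Primrec.fst.comp h1) (Primrec.fst.comp h2)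
        (Primrec.fst.comp h3) Primrec.snd)
  obtain ⟨c, hc⟩ := hD.exists_complexity_enum_le hf (h := fun l => e l.toFinset) he.1
  refine ⟨c, fun n a b j x y F ha hF hcard => ?_⟩
  set U : Finset (List Bool × List Bool) := cube n ×ˢ cube n with hUdef
  have hU : U.card = 2 ^ n * 2 ^ n := by rw [Finset.card_product, card_cube]
  have hmodel : ∀ t, ∀ A ∈ smallModels r n a b t,
      A.Nodup ∧ A.toFinset ⊆ cube n ∧ A.length < 2 ^ (b + 1) := by
    intro t A hA
    obtain ⟨⟨s, hs, p, hp, l, hl, rfl⟩, hlen⟩ := mem_smallModels.1 hA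
    exact ⟨nodup_restrictCube n l, fun z hz => (mem_restrictCube.1 (List.mem_toFinset.1 hz)).1, hlen⟩
  have hnd : ∀ t, ∀ A ∈ smallModels r n a b t, (pts A).Nodup := by
    intro t A hA
    exact (hmodel t A hA).1.product (hmodel t A hA).1
  have hmem : ∀ t, ∀ A ∈ smallModels r n a b t, ∀ u, u ∈ pts A ↔ u ∈ U ∧ inc u A = true := by
    rintro t A hA ⟨u, v⟩
    have hsub := (hmodel t A hA).2.1
    simp only [pts, inc, hUdef, List.mem_flatMap, List.mem_map, Prod.mk.injEq, Finset.mem_product,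
      Bool.and_eq_true, decide_eq_true_eq]
    constructor
    · rintro ⟨u', hu, v', hv, rfl, rfl⟩
      exact ⟨⟨hsub (List.mem_toFinset.2 hu), hsub (List.mem_toFinset.2 hv)⟩, hu, hv⟩
    · rintro ⟨-, hu, hv⟩
      exact ⟨u, hu, v, hv, rfl, rfl⟩
  have hstage : ∃ t, ∀ A ∈ F, ∃ l ∈ smallModels r n a b t, l.toFinset = A := by
    have : ∀ A ∈ F, ∃ l t, l ∈ smallModels r n a b t ∧ l.toFinset = A := by
      intro A hAF
      obtain ⟨h1, -, -, h2, h3⟩ := hF A hAF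
      exact h2 ▸ hA n b A h1 h3
    choose! l t hl hlA using this
    exact ⟨F.sup t, fun A hAF =>
      ⟨l A, (prefix_smallModels _ _ _ (Finset.le_sup hAF)).subset (hl A hAF), hlA A hAF⟩⟩
  obtain ⟨t, ht⟩ := hstage
  have hcount : 2 ^ j * (6 * n + 2) ≤ ((smallModels r n a b t).filter (inc (x, y))).length := by
    refine hcard.trans ?_
    rw [← List.toFinset_card_of_nodup ((nodup_smallModels n a b t).filter _)]
    choose! l hl hlA using ht
    refine Finset.card_le_card_of_injOn l (fun A hAF => ?_) fun A hAF B hBF h => ?_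
    · obtain ⟨-, hx, hy, -, -⟩ := hF A hAF
      rw [← hlA A hAF, List.mem_toFinset] at hx hy
      rw [Finset.mem_coe, List.mem_toFinset, List.mem_filter]
      exact ⟨hl A hAF, by simp [inc, hx, hy]⟩
    · rw [← hlA A hAF, ← hlA B hBF, h]
  have hlen : ∀ t, (smallModels r n a b t).length ≤ 2 ^ a := length_smallModels_le hmono n a b
  have hxy : (x, y) ∈ U := by
    have hpos : 0 < F.card := lt_of_lt_of_le (by positivity) hcard
    obtain ⟨A, hAF⟩ := Finset.card_pos.1 hpos
    obtain ⟨h1, hx, hy, -, -⟩ := hF A hAF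
    exact Finset.mem_product.2 ⟨h1 hx, h1 hy⟩
  -- Here Λ = 2^(2n), q = 2^j and at most 2^a ≤ 2^(4n) sets arrive. This is where the factor 6n + 2
  -- in the multiplicity comes from.
  have hweight : 2 ^ n * 2 ^ n * (2 ^ j + (smallModels r n a b t).length) <
      2 ^ j * 2 ^ (6 * n + 2) := by
    have h1 : (smallModels r n a b t).length ≤ 2 ^ j * 2 ^ (4 * n) :=
      (hlen t).trans ((Nat.pow_le_pow_right (by norm_num) ha).trans
        (Nat.le_mul_of_pos_left _ (by positivity)))
    have h2 : 2 ^ j ≤ 2 ^ j * 2 ^ (4 * n) := Nat.le_mul_of_pos_right _ (by positivity)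
    have h3 : 2 ^ n * 2 ^ n * (2 ^ j * 2 ^ (4 * n) + 2 ^ j * 2 ^ (4 * n)) =
        2 ^ j * 2 ^ (6 * n + 1) := by
      rw [← two_mul, show 6 * n + 1 = n + n + (4 * n + 1) by ring, pow_add, pow_add, pow_add]
      ring
    calc _ ≤ 2 ^ n * 2 ^ n * (2 ^ j * 2 ^ (4 * n) + 2 ^ j * 2 ^ (4 * n)) :=
          Nat.mul_le_mul_left _ (Nat.add_le_add h2 h1)
      _ = 2 ^ j * 2 ^ (6 * n + 1) := h3
      _ < _ := Nat.mul_lt_mul_of_pos_left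
          (Nat.pow_lt_pow_right (by norm_num) (by omega)) (by positivity)
  obtain ⟨A, hApick, hAxy⟩ := exists_mem_coverPicks hU (by positivity) _ (hnd t) (hmem t)
    hweight hxy hcount
  obtain ⟨hA1, hA2, hA3⟩ := hmodel t A (coverPicks_subset _ hApick)
  simp only [inc, Bool.and_eq_true, decide_eq_true_eq] at hAxy
  have hj : j ≤ a := (Nat.pow_le_pow_iff_right (a := 2) (by norm_num)).1
    ((Nat.le_mul_of_pos_right _ (by omega)).trans
      (hcount.trans ((List.length_filter_le _ _).trans (hlen t))))
  refine ⟨hj, A.toFinset, hA2, List.mem_toFinset.2 hAxy.1, List.mem_toFinset.2 hAxy.2,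
    (List.toFinset_card_le A).trans_lt hA3, ?_⟩
  refine hc _ _ t A ?_ fun S hS => ?_
  · simpa only [f, f', Nat.unpair_pair] using hApick
  · refine card_le_of_monotone_lists (fun s t hst => ?_) (fun t => ?_) S hS
    · exact coverPicks_subset_of_prefix (prefix_smallModels _ _ _ hst)
    · simp only [f, f', Nat.unpair_pair]
      -- The number of picks is at most 1 + 2^(a - j) ≤ 2^(a - j + 1).
      have h := coverPicks_length_le (q := 2 ^ j) hU (by positivity) (by positivity) _
        (hnd t) (hmem t)
      have h1 : 2 ^ a = 2 ^ j * 2 ^ (a - j) := by rw [← pow_add, Nat.add_sub_cancel' hj]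
      have h2 : 2 ^ j * (coverPicks inc pts (2 ^ j) (2 ^ n * 2 ^ n)
          (smallModels r n a b t)).length ≤ 2 ^ j * (1 + 2 ^ (a - j)) := by
        have := hlen t
        rw [mul_add, mul_one, ← h1]
        omega
      have h3 := Nat.le_of_mul_le_mul_left h2 (by positivity)
      have h4 : 1 ≤ 2 ^ (a - j) := Nat.one_le_two_pow
      rw [pow_succ]
      omega

end Descriptions

/-! ### Absorbing parameters into multiples of log n. -/

theorem one_le_logb_two {n : ℕ} (hn : 2 ≤ n) : 1 ≤ Real.logb 2 n := by
  rw [Real.le_logb_iff_rpow_le (by norm_num) (by positivity), Real.rpow_one]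
  exact_mod_cast hn

theorem two_rpow_mul_logb {n : ℕ} (hn : 2 ≤ n) (m : ℕ) :
    (2 : ℝ) ^ ((m : ℝ) * Real.logb 2 n) = (n : ℝ) ^ m := by
  rw [mul_comm, Real.rpow_mul (by norm_num),
    Real.rpow_logb (by norm_num) (by norm_num) (by positivity), Real.rpow_natCast]

/-- A parameter polynomial in `n` costs O(log n) bits. The extra 1 absorbs the rounding, since log n
≥ 1. -/
theorem natSize_le_mul_logb {n m q : ℕ} (hn : 2 ≤ n) (hq : q < n ^ m) :
    (q.size : ℝ) ≤ (m + 1) * Real.logb 2 n := by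
  have hl := one_le_logb_two hn
  have h : q.size ≤ ⌈(m : ℝ) * Real.logb 2 n⌉₊ := by
    rw [Nat.size_le]
    refine hq.trans_le ?_
    have : (n : ℝ) ^ m ≤ 2 ^ ⌈(m : ℝ) * Real.logb 2 n⌉₊ := by
      rw [← two_rpow_mul_logb hn, ← Real.rpow_natCast]
      exact Real.rpow_le_rpow_of_exponent_le (by norm_num) (Nat.le_ceil _)
    exact_mod_cast this
  have h1 : (q.size : ℝ) ≤ ⌈(m : ℝ) * Real.logb 2 n⌉₊ := by exact_mod_cast h
  have h2 := Nat.ceil_lt_add_one (a := (m : ℝ) * Real.logb 2 n) (by positivity)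
  linarith

theorem pair_lt_pow {n m u v : ℕ} (hu : u < n ^ m) (hv : v < n ^ m) :
    Nat.pair u v < n ^ (2 * m) := by
  refine (Nat.pair_lt_max_add_one_sq u v).trans_le ?_
  rw [mul_comm, pow_mul]
  exact Nat.pow_le_pow_left (by omega) 2

theorem lt_pow_four {n a : ℕ} (hn : 2 ≤ n) (ha : a ≤ 4 * n) : a < n ^ 4 := by
  have : 2 ^ 3 ≤ n ^ 3 := Nat.pow_le_pow_left hn 3
  have : n ^ 4 = n ^ 3 * n := pow_succ n 3
  nlinarith

theorem card_eq_two_rpow {A : Finset (List Bool)} (hA : A.Nonempty) :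
    (A.card : ℝ) = 2 ^ Real.logb 2 (A.card : ℝ) :=
  (Real.rpow_logb (by norm_num) (by norm_num) (by exact_mod_cast hA.card_pos)).symm

theorem two_rpow_le_iff {a b : ℝ} : (2 : ℝ) ^ a ≤ 2 ^ b ↔ a ≤ b :=
  Real.rpow_le_rpow_left_iff (by norm_num)

theorem card_lt_two_pow_log {A : Finset (List Bool)} :
    A.card < 2 ^ (Nat.log 2 A.card + 1) := Nat.lt_pow_succ_log_self (by norm_num) _

theorem natLog_card_le_logb {A : Finset (List Bool)} (hA : A.Nonempty) :
    (Nat.log 2 A.card : ℝ) ≤ Real.logb 2 (A.card : ℝ) := by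
  rw [Real.le_logb_iff_rpow_le (by norm_num) (by exact_mod_cast hA.card_pos), Real.rpow_natCast]
  exact_mod_cast Nat.pow_log_le_self 2 hA.card_pos.ne'

theorem natLog_card_le {n : ℕ} {A : Finset (List Bool)} (hA : A ⊆ cube n) :
    Nat.log 2 A.card ≤ n := by
  have := Finset.card_le_card hA
  rw [card_cube] at this
  calc Nat.log 2 A.card ≤ Nat.log 2 (2 ^ n) := Nat.log_mono_right this
    _ = n := Nat.log_pow (by norm_num) n

/-! ### Estimates up to O(log n) in the exponent. -/

section Estimates

variable {D : List Bool →. List Bool} {M : ProbMachine} {e : Finset (List Bool) → List Bool}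

/-- The bound C(z) ≤ k + O(log k) for strings of probability above 2^(-k) is inverted: too large a
probability would make `z` simpler than it is. -/
theorem exists_prob_le (hD : IsOptimal D) : ∃ K : ℝ, 0 ≤ K ∧ ∀ n : ℕ, 2 ≤ n → ∀ z,
    complexity D z ≤ 4 * n →
      M.prob z ≤ 2 ^ (-(complexity D z : ℝ) + K * Real.logb 2 n) := by
  obtain ⟨c, hc⟩ := M.exists_complexity_le hD
  -- The size of k ≤ 4n is at most 5 log n, so 2 · 5 + 1 covers the parameter and the rounding of
  -- `k`.
  refine ⟨11 + c, by positivity, fun n hn z hz => ?_⟩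
  have hl := one_le_logb_two hn
  set l := Real.logb 2 n
  set a := complexity D z with ha
  rcases le_total (a : ℝ) ((11 + c) * l) with h | h
  · exact (M.prob_le_one z).trans (Real.one_le_rpow (by norm_num) (by linarith))
  by_contra! hlt
  set k := ⌈(a : ℝ) - (11 + c) * l⌉₊ with hk
  have h1 : (k : ℝ) < a - (11 + c) * l + 1 := Nat.ceil_lt_add_one (by linarith)
  have h2 : (a : ℝ) - (11 + c) * l ≤ k := Nat.le_ceil _
  have hka : k ≤ a := by
    rw [hk, Nat.ceil_le]
    have : 0 ≤ (11 + (c : ℝ)) * l := by positivity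
    linarith
  have h3 := hc k z (lt_of_le_of_lt (by
    rw [← Real.rpow_natCast, Real.inv_rpow (by norm_num), ← Real.rpow_neg (by norm_num),
      two_rpow_le_iff]
    linarith) hlt)
  have h4 := natSize_le_mul_logb hn (lt_pow_four hn (hka.trans hz))
  have h5 : (a : ℝ) ≤ k + 2 * k.size + c := by exact_mod_cast h3
  have h6 : (c : ℝ) ≤ c * l := le_mul_of_one_le_right (by positivity) hl
  push_cast at h4
  nlinarith

theorem exists_le_prob (hD : IsOptimal D) (hM : M.IsUniversal) : ∃ K : ℝ, 0 ≤ K ∧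
    ∀ n : ℕ, 2 ≤ n → ∀ z, complexity D z ≤ 4 * n →
      (2 : ℝ) ^ (-(complexity D z : ℝ) - K * Real.logb 2 n) ≤ M.prob z := by
  obtain ⟨c, hc⟩ := hM.exists_le_prob hD
  refine ⟨10 + c, by positivity, fun n hn z hz => le_trans ?_ (hc z)⟩
  have hl := one_le_logb_two hn
  have h4 := natSize_le_mul_logb hn (lt_pow_four hn hz)
  have h6 : (c : ℝ) ≤ c * Real.logb 2 n := le_mul_of_one_le_right (by positivity) hl
  rw [← Real.rpow_natCast, Real.inv_rpow (by norm_num), ← Real.rpow_neg (by norm_num),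
    two_rpow_le_iff]
  push_cast at h4 ⊢
  linarith

theorem exists_complexity_le_add_logb_card (hD : IsOptimal D) (he : IsComputableEncoding e) :
    ∃ K : ℝ, 0 ≤ K ∧ ∀ n : ℕ, 2 ≤ n → ∀ A x, A ⊆ cube n → x ∈ A →
      complexity D (e A) ≤ 4 * n →
      (complexity D x : ℝ) ≤
        complexity D (e A) + Real.logb 2 (A.card : ℝ) + K * Real.logb 2 n := by
  obtain ⟨c, hc⟩ := exists_complexity_le_of_mem hD he
  refine ⟨35 + c, by positivity, fun n hn A x hA hx hC => ?_⟩
  have hl := one_le_logb_two hn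
  have h := hc n _ A x hA hx card_lt_two_pow_log
  have h1 := natLog_card_le_logb ⟨x, hx⟩
  have hb := natLog_card_le hA
  have h2 := natSize_le_mul_logb hn (pair_lt_pow
    ((lt_pow_four hn (by omega : n ≤ 4 * n)).trans_le (Nat.pow_le_pow_right (by omega)
      (by norm_num : 4 ≤ 2 * 4)))
    (pair_lt_pow (lt_pow_four hn hC) (lt_pow_four hn (by omega : Nat.log 2 A.card ≤ 4 * n))))
  have h3 : (complexity D x : ℝ) ≤ complexity D (e A) + Nat.log 2 A.card + 1 +
    2 * (Nat.pair n (Nat.pair (complexity D (e A)) (Nat.log 2 A.card))).size + c := by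
    exact_mod_cast h
  have h6 : (c : ℝ) ≤ c * Real.logb 2 n := le_mul_of_one_le_right (by positivity) hl
  push_cast at h2
  linarith

/-- A bound for the number of sets containing `x` and `y` in terms of the least value `κ` of
`C(A) + log₂ |A|` for such sets. -/
theorem exists_card_models_le (hD : IsOptimal D) (he : IsComputableEncoding e) :
    ∃ K : ℝ, 0 ≤ K ∧ ∀ n : ℕ, 2 ≤ n → ∀ (x y : List Bool) (κ : ℝ),
      (∀ A : Finset (List Bool), A ⊆ cube n → x ∈ A → y ∈ A →
        κ ≤ complexity D (e A) + Real.logb 2 (A.card : ℝ)) →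
      ∀ (a b : ℕ) (F : Finset (Finset (List Bool))), a ≤ 4 * n → b ≤ n →
      (∀ A ∈ F, A ⊆ cube n ∧ x ∈ A ∧ y ∈ A ∧ complexity D (e A) = a ∧ A.card < 2 ^ (b + 1)) →
      (F.card : ℝ) ≤ 2 ^ ((a : ℝ) + b - κ + K * Real.logb 2 n) := by
  obtain ⟨c, hc⟩ := exists_simpler_model hD he
  -- The nested pair is below n^32, so it costs 2 · 33 = 66. Then 4 pays for 6n + 2 ≤ n^4, and 3 for
  -- the rounding of the index length, of the set size and of `j`.
  refine ⟨73 + c, by positivity, fun n hn x y κ hκ a b F ha hb hF => ?_⟩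
  have hl := one_le_logb_two hn
  have hcl : (c : ℝ) ≤ c * Real.logb 2 n := le_mul_of_one_le_right (by positivity) hl
  have hlog : ∀ A : Finset (List Bool), x ∈ A → A.card < 2 ^ (b + 1) →
      Real.logb 2 (A.card : ℝ) ≤ b + 1 := by
    intro A hx hA
    rw [← two_rpow_le_iff, ← card_eq_two_rpow ⟨x, hx⟩]
    have : (A.card : ℝ) ≤ 2 ^ (b + 1) := by exact_mod_cast hA.le
    rwa [← Real.rpow_natCast, Nat.cast_add, Nat.cast_one] at this
  have h6n : ((6 * n + 2 : ℕ) : ℝ) ≤ 2 ^ ((4 : ℕ) * Real.logb 2 n) := by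
    rw [two_rpow_mul_logb hn]
    have h3 : 2 ^ 3 ≤ n ^ 3 := Nat.pow_le_pow_left hn 3
    have h4 : n ^ 4 = n ^ 3 * n := pow_succ n 3
    have : 6 * n + 2 ≤ n ^ 4 := by nlinarith
    exact_mod_cast this
  push_cast at h6n
  rcases lt_or_ge F.card (6 * n + 2) with hsmall | hlarge
  -- If `F` is empty, `κ` may be arbitrarily large but the bound is trivial. Otherwise any member
  -- gives κ ≤ a + b + 1.
  · rcases F.eq_empty_or_nonempty with rfl | ⟨A, hAF⟩
    · simp only [Finset.card_empty, Nat.cast_zero]; positivity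
    obtain ⟨h1, hx, hy, rfl, h3⟩ := hF A hAF
    have := hκ A h1 hx hy
    have := hlog A hx h3
    have h5 : (F.card : ℝ) ≤ 6 * n + 2 := by exact_mod_cast hsmall.le
    refine h5.trans (h6n.trans (two_rpow_le_iff.2 ?_))
    nlinarith
  -- This is the largest `j` for which the family is big enough for a simpler set. That set forces κ
  -- ≤ a - j + b + O(log n), which bounds `j` and with it the cardinality.
  · set j := Nat.log 2 (F.card / (6 * n + 2)) with hj
    have hpos : F.card / (6 * n + 2) ≠ 0 := (Nat.div_pos hlarge (by omega)).ne'
    have hj1 : 2 ^ j * (6 * n + 2) ≤ F.card :=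
      (Nat.mul_le_mul_right _ (Nat.pow_log_le_self 2 hpos)).trans (Nat.div_mul_le_self _ _)
    have hj2 : F.card < 2 ^ (j + 1) * (6 * n + 2) := by
      rw [← Nat.div_lt_iff_lt_mul (by omega)]
      exact Nat.lt_pow_succ_log_self (by norm_num) _
    obtain ⟨hja, A, h1, hx, hy, h3, h4⟩ := hc n a b j x y F ha hF hj1
    have h5 := natSize_le_mul_logb hn (pair_lt_pow
      ((lt_pow_four hn (by omega : n ≤ 4 * n)).trans_le (Nat.pow_le_pow_right (by omega)
        (by norm_num : 4 ≤ 2 * (2 * 4))))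
      (pair_lt_pow ((lt_pow_four hn ha).trans_le (Nat.pow_le_pow_right (by omega)
        (by norm_num : 4 ≤ 2 * 4)))
        (pair_lt_pow (lt_pow_four hn (by omega : b ≤ 4 * n))
          (lt_pow_four hn (by omega : j ≤ 4 * n)))))
    have h6 : (complexity D (e A) : ℝ) ≤
        a - j + 1 + 2 * (Nat.pair n (Nat.pair a (Nat.pair b j))).size + c := by
      rw [← Nat.cast_sub hja]; exact_mod_cast h4
    push_cast at h5
    have h7 := hκ A h1 hx hy
    have h8 := hlog A hx h3
    have h9 : (F.card : ℝ) ≤ 2 ^ ((j : ℝ) + 1) * (6 * n + 2) := by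
      have : ((j : ℝ) + 1) = ((j + 1 : ℕ) : ℝ) := by push_cast; rfl
      rw [this, Real.rpow_natCast]
      exact_mod_cast hj2.le
    refine h9.trans ((mul_le_mul_of_nonneg_left h6n (by positivity)).trans ?_)
    rw [← Real.rpow_add (by norm_num), two_rpow_le_iff]
    nlinarith

theorem mem_models {n : ℕ} {A : Finset (List Bool)} :
    A ∈ models D e n ↔ A ⊆ cube n ∧ complexity D (e A) ≤ 4 * n := by
  rw [models, Finset.mem_filter, Finset.mem_powerset]

/-- Within each class of given `a` and `b`, the bounds on the number of sets and on a single term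
multiply to 2^(-κ + O(log n)). There are at most (4n + 1)(n + 1) ≤ n^6 classes. -/
theorem exists_sum_models_le (hD : IsOptimal D) (he : IsComputableEncoding e) :
    ∃ K : ℝ, 0 ≤ K ∧ ∀ n : ℕ, 2 ≤ n → ∀ (x y : List Bool) (κ : ℝ),
      (∀ A : Finset (List Bool), A ⊆ cube n → x ∈ A → y ∈ A →
        κ ≤ complexity D (e A) + Real.logb 2 (A.card : ℝ)) →
      ∑ A ∈ (models D e n).filter (fun A => x ∈ A ∧ y ∈ A), M.prob (e A) / (A.card : ℝ) ≤
        2 ^ (-κ + K * Real.logb 2 n) := by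
  obtain ⟨K₁, hK₁, h₁⟩ := exists_card_models_le hD he
  obtain ⟨K₂, hK₂, h₂⟩ := exists_prob_le (M := M) hD
  refine ⟨K₁ + K₂ + 6, by positivity, fun n hn x y κ hκ => ?_⟩
  have hl := one_le_logb_two hn
  set l := Real.logb 2 n
  set G := (models D e n).filter (fun A => x ∈ A ∧ y ∈ A) with hG
  have hmem : ∀ A ∈ G, (A ⊆ cube n ∧ complexity D (e A) ≤ 4 * n) ∧ x ∈ A ∧ y ∈ A := by
    intro A hA
    rw [hG, Finset.mem_filter, mem_models] at hA
    exact hA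
  have hmaps : ∀ A ∈ G, (complexity D (e A), Nat.log 2 A.card) ∈
      Finset.range (4 * n + 1) ×ˢ Finset.range (n + 1) := by
    intro A hA
    obtain ⟨⟨h1, h2⟩, -⟩ := hmem A hA
    rw [Finset.mem_product, Finset.mem_range, Finset.mem_range]
    exact ⟨Nat.lt_succ_of_le h2, Nat.lt_succ_of_le (natLog_card_le h1)⟩
  rw [← Finset.sum_fiberwise_of_maps_to hmaps]
  have hfiber : ∀ ab ∈ Finset.range (4 * n + 1) ×ˢ Finset.range (n + 1),
      ∑ A ∈ G.filter (fun A => (complexity D (e A), Nat.log 2 A.card) = ab),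
        M.prob (e A) / (A.card : ℝ) ≤ 2 ^ (-κ + (K₁ + K₂) * l) := by
    rintro ⟨a, b⟩ hab
    rw [Finset.mem_product, Finset.mem_range, Finset.mem_range] at hab
    simp only [Prod.mk.injEq]
    set F := G.filter (fun A => complexity D (e A) = a ∧ Nat.log 2 A.card = b)
    have hF : ∀ A ∈ F, ((A ⊆ cube n ∧ complexity D (e A) ≤ 4 * n) ∧ x ∈ A ∧ y ∈ A) ∧
        complexity D (e A) = a ∧ Nat.log 2 A.card = b := fun A hA =>
      ⟨hmem A (Finset.mem_filter.1 hA).1, (Finset.mem_filter.1 hA).2⟩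
    have hcard := h₁ n hn x y κ hκ a b F (by omega) (by omega) fun A hA => by
      obtain ⟨⟨⟨h1, -⟩, hx, hy⟩, h2, h3⟩ := hF A hA
      exact ⟨h1, hx, hy, h2, h3 ▸ card_lt_two_pow_log⟩
    have hterm : ∀ A ∈ F, M.prob (e A) / (A.card : ℝ) ≤ 2 ^ (-(a : ℝ) + K₂ * l - b) := by
      intro A hA
      obtain ⟨⟨⟨-, hC⟩, hx, -⟩, h2, h3⟩ := hF A hA
      rw [Real.rpow_sub (by norm_num)]
      have hlog := natLog_card_le_logb ⟨x, hx⟩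
      rw [h3] at hlog
      have hp := h₂ n hn (e A) hC
      rw [h2] at hp
      refine div_le_div₀ (by positivity) hp (by positivity) ?_
      rw [card_eq_two_rpow ⟨x, hx⟩, two_rpow_le_iff]
      exact hlog
    refine (Finset.sum_le_card_nsmul F _ _ hterm).trans ?_
    rw [nsmul_eq_mul]
    refine (mul_le_mul_of_nonneg_right hcard (by positivity)).trans ?_
    rw [← Real.rpow_add (by norm_num), two_rpow_le_iff]
    linarith
  refine (Finset.sum_le_card_nsmul _ _ _ hfiber).trans ?_
  rw [Finset.card_product, Finset.card_range, Finset.card_range, nsmul_eq_mul]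
  have hcount : (((4 * n + 1) * (n + 1) : ℕ) : ℝ) ≤ 2 ^ ((6 : ℕ) * l) := by
    rw [two_rpow_mul_logb hn]
    have h1 : 4 * n + 1 ≤ n ^ 4 := lt_pow_four hn le_rfl
    have h2 : n + 1 ≤ n ^ 2 := by nlinarith
    have : (4 * n + 1) * (n + 1) ≤ n ^ 6 := (Nat.mul_le_mul h1 h2).trans (by rw [← pow_add])
    exact_mod_cast this
  refine (mul_le_mul_of_nonneg_right hcount (by positivity)).trans ?_
  rw [← Real.rpow_add (by norm_num), two_rpow_le_iff]
  push_cast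
  linarith

theorem exists_le_sum_models (hD : IsOptimal D) (hM : M.IsUniversal) :
    ∃ K : ℝ, 0 ≤ K ∧ ∀ n : ℕ, 2 ≤ n → ∀ (A : Finset (List Bool)) (x y : List Bool),
      A ⊆ cube n → complexity D (e A) ≤ 4 * n → x ∈ A → y ∈ A →
      (2 : ℝ) ^ (-(complexity D (e A) + Real.logb 2 (A.card : ℝ)) - K * Real.logb 2 n) ≤
        ∑ A ∈ (models D e n).filter (fun A => x ∈ A ∧ y ∈ A), M.prob (e A) / (A.card : ℝ) := by
  obtain ⟨K, hK, h⟩ := exists_le_prob hD hM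
  refine ⟨K, hK, fun n hn A x y hA hC hx hy => ?_⟩
  refine le_trans ?_ (Finset.single_le_sum (f := fun A => M.prob (e A) / (A.card : ℝ))
    (fun B _ => div_nonneg (M.prob_nonneg _) (Nat.cast_nonneg _))
    (Finset.mem_filter.2 ⟨mem_models.2 ⟨hA, hC⟩, hx, hy⟩))
  have h1 : -((complexity D (e A) : ℝ) + Real.logb 2 (A.card : ℝ)) - K * Real.logb 2 n =
    (-(complexity D (e A) : ℝ) - K * Real.logb 2 n) - Real.logb 2 (A.card : ℝ) := by ring
  rw [h1, Real.rpow_sub (by norm_num), ← card_eq_two_rpow ⟨x, hx⟩]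
  exact div_le_div_of_nonneg_right (h n hn _ hC) (Nat.cast_nonneg _)

end Estimates

end AlgStat


/-! ### Comparison of the two neighbourhoods. -/

theorem theorem1 (D : List Bool →. List Bool) (hD : AlgStat.IsOptimal D)
    (M : AlgStat.ProbMachine) (hM : M.IsUniversal)
    (e : Finset (List Bool) → List Bool) (he : AlgStat.IsComputableEncoding e) :
    ∃ (c : ℝ) (N : ℕ), ∀ n : ℕ, N ≤ n → ∀ x : List Bool, x.length = n → ∀ d : ℝ,
      AlgStat.algNbhd D e x d ⊆ AlgStat.probNbhd D M e x (d + c * Real.logb 2 (n : ℝ)) ∧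
      AlgStat.probNbhd D M e x d ⊆ AlgStat.algNbhd D e x (d + c * Real.logb 2 (n : ℝ)) := by
  obtain ⟨K₁, hK₁, upper⟩ := AlgStat.exists_sum_models_le (M := M) hD he
  obtain ⟨K₂, hK₂, lower⟩ := AlgStat.exists_le_sum_models (e := e) hD hM
  obtain ⟨K₃, hK₃, twoPart⟩ := AlgStat.exists_complexity_le_add_logb_card hD he
  obtain ⟨c₁, hc₁⟩ := hD.exists_complexity_le
  obtain ⟨c₂, hc₂⟩ := AlgStat.exists_complexity_singleton_le hD he
  obtain ⟨c₃, hc₃⟩ := AlgStat.exists_complexity_cube_le hD he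
  -- The threshold guarantees that {x} and the cube have complexity at most 4n. The summand 6 is
  -- twice the bound 3 log n on the size of `n`, paid when describing the cube.
  refine ⟨K₁ + K₂ + K₃ + c₂ + c₃ + 6, c₁ + c₂ + c₃ + 2, ?_⟩
  rintro n hNn x rfl d
  set n := x.length with hnx
  have hn : 2 ≤ n := by omega
  have hl := AlgStat.one_le_logb_two hn
  have hcl₂ : (c₂ : ℝ) ≤ c₂ * Real.logb 2 n := le_mul_of_one_le_right (by positivity) hl
  have hcl₃ : (c₃ : ℝ) ≤ c₃ * Real.logb 2 n := le_mul_of_one_le_right (by positivity) hl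
  have hsize := AlgStat.natSize_le_mul_logb (q := n) (m := 2) hn (by nlinarith)
  push_cast at hsize
  set l := Real.logb 2 (n : ℝ)
  have hCx : AlgStat.complexity D x ≤ n + c₁ := hc₁ x
  have hxn : x ∈ AlgStat.cube n := AlgStat.mem_cube.2 rfl
  have hCs : AlgStat.complexity D (e {x}) ≤ AlgStat.complexity D x + c₂ := hc₂ x
  have hCs' : (AlgStat.complexity D (e {x}) : ℝ) ≤ AlgStat.complexity D x + c₂ := by
    exact_mod_cast hCs
  have hCc : AlgStat.complexity D (e (AlgStat.cube n)) ≤ 4 * n := by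
    have h1 := hc₃ n
    have h2 : n.size ≤ n := Nat.size_le.2 Nat.lt_two_pow_self
    omega
  have hCc' : (AlgStat.complexity D (e (AlgStat.cube n)) : ℝ) ≤ 2 * n.size + c₃ := by
    exact_mod_cast hc₃ n
  have hcubeLog : Real.logb 2 ((AlgStat.cube n).card : ℝ) = n := by
    rw [AlgStat.card_cube, Nat.cast_pow, Nat.cast_ofNat, ← Real.rpow_natCast,
      Real.logb_rpow (by norm_num) (by norm_num)]
  set den := ∑ A ∈ (AlgStat.models D e n).filter (fun A => x ∈ A), M.prob (e A) / (A.card : ℝ)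
    with hden
  have hden' : den = ∑ A ∈ (AlgStat.models D e n).filter (fun A => x ∈ A ∧ x ∈ A),
      M.prob (e A) / (A.card : ℝ) := by simp only [and_self, hden]
  have hdenLower : (2 : ℝ) ^ (-(AlgStat.complexity D x : ℝ) - (K₂ + c₂) * l) ≤ den := by
    rw [hden']
    refine le_trans ?_ (lower n hn {x} x x (Finset.singleton_subset_iff.2 hxn) (by omega)
      (Finset.mem_singleton_self x) (Finset.mem_singleton_self x))
    rw [AlgStat.two_rpow_le_iff, Finset.card_singleton, Nat.cast_one, Real.logb_one]
    linarith
  have hdenPos : 0 < den := lt_of_lt_of_le (by positivity) hdenLower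
  have hdenUpper : den ≤ 2 ^ (-(AlgStat.complexity D x : ℝ) + (K₁ + K₃) * l) := by
    rw [hden']
    refine (upper n hn x x (AlgStat.complexity D x - K₃ * l) fun A hA hx _ => ?_).trans ?_
    -- The two-part bound is available only up to complexity 4n, but beyond that already C(A)
    -- exceeds C(x).
    · rcases le_or_gt (AlgStat.complexity D (e A)) (4 * n) with h | h
      · linarith [twoPart n hn A x hA hx h]
      · have h1 : (AlgStat.complexity D x : ℝ) ≤ AlgStat.complexity D (e A) := by
          have : AlgStat.complexity D x ≤ AlgStat.complexity D (e A) := by omega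
          exact_mod_cast this
        have h2 := AlgStat.natLog_card_le_logb ⟨x, hx⟩
        have h3 : (0 : ℝ) ≤ Nat.log 2 A.card := Nat.cast_nonneg _
        nlinarith
    · rw [AlgStat.two_rpow_le_iff]; linarith
  constructor
  · rintro y ⟨A, hA, hx, hδ, hy⟩
    obtain ⟨B, hB, hBC, hBx, hBy, hBd⟩ : ∃ B : Finset (List Bool), B ⊆ AlgStat.cube n ∧
        AlgStat.complexity D (e B) ≤ 4 * n ∧ x ∈ B ∧ y ∈ B ∧
        (AlgStat.complexity D (e B) : ℝ) + Real.logb 2 (B.card : ℝ) -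
          AlgStat.complexity D x ≤ d + (6 + c₃) * l := by
      unfold AlgStat.optDeficiency at hδ
      rcases le_or_gt (AlgStat.complexity D (e A)) (4 * n) with h | h
      · exact ⟨A, hA, h, hx, hy, by nlinarith⟩
      -- A set with C(A) > 4n is not a summand of p(y | x). The cube contains `y` too, and C(cube) +
      -- n is at most n + O(log n), hence no worse than C(A) up to the logarithmic term.
      · refine ⟨AlgStat.cube n, subset_rfl, hCc, hxn, hA hy, ?_⟩
        have h1 : (4 : ℝ) * n ≤ AlgStat.complexity D (e A) := by exact_mod_cast h.le
        have h2 := AlgStat.natLog_card_le_logb ⟨x, hx⟩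
        have h3 : (0 : ℝ) ≤ Nat.log 2 A.card := Nat.cast_nonneg _
        have h4 : (0 : ℝ) ≤ n := Nat.cast_nonneg _
        rw [hcubeLog]
        linarith
    change _ ≤ _ / den
    rw [le_div_iff₀ hdenPos]
    refine le_trans ?_ (lower n hn B x y hB hBC hBx hBy)
    refine (mul_le_mul_of_nonneg_left hdenUpper (by positivity)).trans ?_
    rw [← Real.rpow_add (by norm_num), AlgStat.two_rpow_le_iff]
    have : 0 ≤ (c₂ : ℝ) * l := by positivity
    linarith
  · intro y hy
    change _ ≤ _ / den at hy
    rw [le_div_iff₀ hdenPos] at hy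
    -- If `y` is not in the larger algorithmic neighbourhood, every set containing both strings has
    -- a large C(A) + log |A|, so the numerator is too small for p(y | x) ≥ 2^(-d). The surplus in
    -- the constant makes the contradiction strict.
    by_contra hno
    have hκ : ∀ A : Finset (List Bool), A ⊆ AlgStat.cube n → x ∈ A → y ∈ A →
        d + (K₁ + K₂ + K₃ + c₂ + c₃ + 6) * l + AlgStat.complexity D x ≤
          AlgStat.complexity D (e A) + Real.logb 2 (A.card : ℝ) := by
      intro A hA hx hyA
      by_contra! hlt
      refine hno ⟨A, hA, hx, ?_, hyA⟩
      unfold AlgStat.optDeficiency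
      linarith
    have h1 := hy.trans (upper n hn x y _ hκ)
    have h2 := (mul_le_mul_of_nonneg_left hdenLower (by positivity)).trans h1
    rw [← Real.rpow_add (by norm_num), AlgStat.two_rpow_le_iff] at h2
    nlinarith
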